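/- Let $\mathbb{H}^3=\{x\in\mathbb{R}^4 : x_1^2+x_2^2+x_3^2-x_4^2=-1,\ x_4>0\}$ and let $\mathrm{O}^+(3,1)$ be its full group of isometries. Let $Q^3=\{x\in\mathbb{H}^3 : |x_i|+|x_j|\le x_4 \text{ for } 1\le i<j\le 3\}$, a right-angled rhombic dodecahedron; let its sides $1$–$4$, $5$–$8$, $9$–$12$ be those with normal vectors $(\pm1,\pm1,0,1)$, $(\pm1,0,\pm1,1)$, $(0,\pm1,\pm1,1)$ respectively. A digit $m\in\{0,\dots,7\}$ denotes the diagonal matrix $\mathrm{diag}(\pm1,\pm1,\pm1,1)$ in which the entries $1$, $2$, $3$ are $-1$ exactly when the binary digit of $m$ of weight $1$, $2$, $4$ respectively is $1$. For a code $k_1k_5k_9$ of three such digits, put $k_S=k_1$, $k_5$, $k_9$ for the sides $S$ numbered $1$–$4$, $5$–$8$, $9$–$12$ respectively, let $r_S$ be the reflection in the side $S$, let $\Gamma<\mathrm{O}^+(3,1)$ be the group generated by the twelve side pairings $r_Sk_S$, and let $Y=\mathbb{H}^3/\Gamma$ be the census manifold with this code, that is, the space obtained from $Q^3$ by these side pairings.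 **Lemma.** Let $Y$ be any of the non-orientable census $3$-manifolds with codes $537$, $152$, $173$, $136$, $156$ (up to isometry, these are the non-orientable cross-sections of the integral congruence two hyperbolic $4$-manifolds $N_{23}$, $N_{71}$, $N_{1091}$, $N_{1092}$), and let $Y^+=\mathbb{H}^3/(\Gamma\cap\mathrm{SO}^+(3,1))$ be its orientable double cover. Then neither $Y^+$ nor $Y$ contains a closed embedded totally geodesic surface (orientable or not). -/

import Mathlib

open scoped Matrix

noncomputable section

namespace CensusHyp

/-- The Lorentzian inner product `x₁y₁ + x₂y₂ + x₃y₃ - x₄y₄` on `ℝ⁴`. -/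
def lor (x y : Fin 4 → ℝ) : ℝ := x 0 * y 0 + x 1 * y 1 + x 2 * y 2 - x 3 * y 3

/-- Hyperbolic 3-space in the hyperboloid model: the upper sheet of `J = -1`, with the subspace
topology (which is the topology of the hyperbolic metric). -/
def H3 : Type := {x : Fin 4 → ℝ // lor x x = -1 ∧ 0 < x 3}

instance : TopologicalSpace H3 := inferInstanceAs (TopologicalSpace {x : Fin 4 → ℝ // lor x x = -1 ∧ 0 < x 3})

/-- The group `O⁺(3,1)` of all isometries of `H3`: the invertible matrices that preserve the
Lorentzian form (`Aᵀ J A = J`) and the upper sheet. -/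
def OPlus : Subgroup (GL (Fin 4) ℝ) where
  carrier := {A | (∀ x y : Fin 4 → ℝ, lor (A.1 *ᵥ x) (A.1 *ᵥ y) = lor x y) ∧
    ∀ x : Fin 4 → ℝ, (lor (A.1 *ᵥ x) (A.1 *ᵥ x) = -1 ∧ 0 < (A.1 *ᵥ x) 3) ↔
      (lor x x = -1 ∧ 0 < x 3)}
  one_mem' := by simp
  mul_mem' := by
    rintro A B ⟨hA, hA'⟩ ⟨hB, hB'⟩
    refine ⟨fun x y => ?_, fun x => ?_⟩
    · have := hA (B.1 *ᵥ x) (B.1 *ᵥ y)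
      rw [hB, Matrix.mulVec_mulVec, Matrix.mulVec_mulVec] at this
      exact this
    · have := hA' (B.1 *ᵥ x)
      rw [hB', Matrix.mulVec_mulVec] at this
      exact this
  inv_mem' := by
    rintro A ⟨hA, hA'⟩
    have key : ∀ x : Fin 4 → ℝ, A.1 *ᵥ ((A⁻¹).1 *ᵥ x) = x := fun x => by
      rw [Matrix.mulVec_mulVec, ← Units.val_mul, mul_inv_cancel]
      simp
    refine ⟨fun x y => ?_, fun x => ?_⟩
    · have := hA ((A⁻¹).1 *ᵥ x) ((A⁻¹).1 *ᵥ y)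
      rw [key, key] at this
      exact this.symm
    · have := hA' ((A⁻¹).1 *ᵥ x)
      rw [key] at this
      exact this.symm

/-- The action of `O⁺(3,1)` on hyperbolic space by matrix-vector multiplication. -/
instance : MulAction OPlus H3 where
  smul A x := ⟨A.1.1 *ᵥ x.1, (A.2.2 x.1).2 x.2⟩
  one_smul x := Subtype.ext (by
    change ((1 : OPlus).1.1) *ᵥ x.1 = x.1
    simp)
  mul_smul A B x := Subtype.ext (by
    change ((A * B).1.1) *ᵥ x.1 = A.1.1 *ᵥ (B.1.1 *ᵥ x.1)
    simp)

/-- The group `SO⁺(3,1)` of orientation-preserving isometries: determinant one. -/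
def SOPlus : Subgroup OPlus :=
  ((Matrix.GeneralLinearGroup.det (n := Fin 4) (R := ℝ)).comp OPlus.subtype).ker

/-! ### Reflections -/

/-- The linear map `x ↦ x - 2⟨x, s⟩ s` as a matrix. -/
def reflMatrix (s : Fin 4 → ℝ) : Matrix (Fin 4) (Fin 4) ℝ :=
  1 - (2 : ℝ) • Matrix.vecMulVec s ![s 0, s 1, s 2, -s 3]

theorem reflMatrix_mulVec (s x : Fin 4 → ℝ) :
    reflMatrix s *ᵥ x = fun i => x i - 2 * lor x s * s i := by
  funext i
  rw [reflMatrix, Matrix.sub_mulVec, Matrix.one_mulVec, Matrix.smul_mulVec]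
  simp [Matrix.mulVec, dotProduct, Fin.sum_univ_four, lor]
  ring

theorem reflMatrix_invol {s : Fin 4 → ℝ} (hs : lor s s = 1) (x : Fin 4 → ℝ) :
    reflMatrix s *ᵥ (reflMatrix s *ᵥ x) = x := by
  funext i
  simp only [reflMatrix_mulVec]
  have h : lor (fun i => x i - 2 * lor x s * s i) s = -lor x s := by
    have : lor (fun i => x i - 2 * lor x s * s i) s = lor x s - 2 * lor x s * lor s s := by
      simp only [lor]; ring
    rw [this, hs]; ring
  rw [h]; ring

theorem reflMatrix_mul_self {s : Fin 4 → ℝ} (hs : lor s s = 1) :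
    reflMatrix s * reflMatrix s = 1 := by
  apply Matrix.mulVec_injective
  funext x
  rw [← Matrix.mulVec_mulVec, reflMatrix_invol hs, Matrix.one_mulVec]

theorem lor_reflMatrix {s : Fin 4 → ℝ} (hs : lor s s = 1) (x y : Fin 4 → ℝ) :
    lor (reflMatrix s *ᵥ x) (reflMatrix s *ᵥ y) = lor x y := by
  rw [reflMatrix_mulVec, reflMatrix_mulVec]
  have : lor (fun i => x i - 2 * lor x s * s i) (fun i => y i - 2 * lor y s * s i)
      = lor x y + 4 * lor x s * lor y s * (lor s s - 1) := by
    simp only [lor]; ring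
  rw [this, hs]; ring

theorem upper_of_lor_neg {x y : Fin 4 → ℝ} (hx : lor x x = -1) (hx3 : 0 < x 3)
    (hy : lor y y = -1) (h : lor x y < 0) : 0 < y 3 := by
  by_contra hneg
  push Not at hneg
  simp only [lor] at *
  set p := x 0 * y 0 + x 1 * y 1 + x 2 * y 2 with hp
  have cs : p ^ 2 ≤ (x 3 ^ 2 - 1) * (y 3 ^ 2 - 1) := by
    have e1 : x 3 ^ 2 - 1 = x 0 ^ 2 + x 1 ^ 2 + x 2 ^ 2 := by linarith
    have e2 : y 3 ^ 2 - 1 = y 0 ^ 2 + y 1 ^ 2 + y 2 ^ 2 := by linarith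
    rw [e1, e2, hp]
    nlinarith [sq_nonneg (x 0 * y 1 - x 1 * y 0), sq_nonneg (x 0 * y 2 - x 2 * y 0),
      sq_nonneg (x 1 * y 2 - x 2 * y 1)]
  have hy2 : 1 ≤ y 3 ^ 2 := by nlinarith [sq_nonneg (y 0), sq_nonneg (y 1), sq_nonneg (y 2)]
  have hx2 : 1 ≤ x 3 ^ 2 := by nlinarith [sq_nonneg (x 0), sq_nonneg (x 1), sq_nonneg (x 2)]
  have hq : 0 ≤ x 3 * (-y 3) := mul_nonneg hx3.le (by linarith)
  have hlt : x 3 * (-y 3) < -p := by linarith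
  have : (x 3 * (-y 3)) ^ 2 < (-p) ^ 2 := by
    exact pow_lt_pow_left₀ hlt hq (by norm_num)
  nlinarith

theorem reflMatrix_upper {s : Fin 4 → ℝ} (hs : lor s s = 1) (x : Fin 4 → ℝ)
    (hx : lor x x = -1 ∧ 0 < x 3) :
    lor (reflMatrix s *ᵥ x) (reflMatrix s *ᵥ x) = -1 ∧ 0 < (reflMatrix s *ᵥ x) 3 := by
  have h1 : lor (reflMatrix s *ᵥ x) (reflMatrix s *ᵥ x) = -1 := by
    rw [lor_reflMatrix hs, hx.1]
  refine ⟨h1, upper_of_lor_neg hx.1 hx.2 h1 ?_⟩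
  have : lor x (reflMatrix s *ᵥ x) = lor x x - 2 * lor x s ^ 2 := by
    rw [reflMatrix_mulVec]; simp only [lor]; ring
  rw [this, hx.1]
  nlinarith [sq_nonneg (lor x s)]

/-- The reflection of `H3` in the totally geodesic plane `⟨x, s⟩ = 0`, where `⟨s, s⟩ = 1`. -/
def lorRefl (s : Fin 4 → ℝ) (hs : lor s s = 1) : OPlus :=
  ⟨⟨reflMatrix s, reflMatrix s, reflMatrix_mul_self hs, reflMatrix_mul_self hs⟩,
    lor_reflMatrix hs, fun x => ⟨fun h => by
      have := reflMatrix_upper hs _ h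
      rwa [reflMatrix_invol hs] at this, reflMatrix_upper hs x⟩⟩

/-! ### The side pairings of the right-angled rhombic dodecahedron -/

/-- The reflection in the coordinate plane `xⱼ₊₁ = 0`. -/
def coordRefl (j : Fin 3) : OPlus :=
  lorRefl (Pi.single j.castSucc 1) (by fin_cases j <;> simp [lor, Fin.ext_iff])

/-- The element of the group `K ≅ (ℤ/2)³` of diagonal matrices `diag(±1, ±1, ±1, 1)` with a given
octal digit: the bits `1`, `2`, `4` of the digit negate `x₁`, `x₂`, `x₃`. For example,
`1 ↔ diag(-1,1,1,1)`, `2 ↔ diag(1,-1,1,1)`, `4 ↔ diag(1,1,-1,1)`, `7 ↔ diag(-1,-1,-1,1)`. -/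
def kElt (m : Fin 8) : OPlus :=
  (if m.val.testBit 0 then coordRefl 0 else 1) * (if m.val.testBit 1 then coordRefl 1 else 1) *
    (if m.val.testBit 2 then coordRefl 2 else 1)

/-- Outward unit normals of the 12 sides of the right-angled rhombic dodecahedron
`Q³ = {x ∈ H3 | |xᵢ| + |xⱼ| ≤ x₄ for 1 ≤ i < j ≤ 3}` (six ideal and eight finite vertices). The sides come in three
`K`-orbits of four: sides `1`-`4` have normals `(±1, ±1, 0, 1)`, sides `5`-`8` have normals
`(±1, 0, ±1, 1)`, sides `9`-`12` have normals `(0, ±1, ±1, 1)`. -/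
def sideNormal : Fin 3 → ℤˣ → ℤˣ → Fin 4 → ℝ
  | 0, ε, δ => ![(ε : ℤ), (δ : ℤ), 0, 1]
  | 1, ε, δ => ![(ε : ℤ), 0, (δ : ℤ), 1]
  | 2, ε, δ => ![0, (ε : ℤ), (δ : ℤ), 1]

theorem lor_sideNormal (p : Fin 3) (ε δ : ℤˣ) : lor (sideNormal p ε δ) (sideNormal p ε δ) = 1 := by
  rcases Int.units_eq_one_or ε with rfl | rfl <;> rcases Int.units_eq_one_or δ with rfl | rfl <;>
    fin_cases p <;> simp [sideNormal, lor]

/-- The reflection `r_S` in a side `S` of `Q³`. -/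
def sideRefl (p : Fin 3) (ε δ : ℤˣ) : OPlus := lorRefl (sideNormal p ε δ) (lor_sideNormal p ε δ)

/-- The group generated by the twelve side pairings `r_S k_S` of `Q³` given by the code
`k₁k₅k₉ = k 0, k 1, k 2`: here `k_S` is the element of `K` with digit `k₁` for the sides `1`-`4`,
`k₅` for the sides `5`-`8`, and `k₉` for the sides `9`-`12`; the side pairing `r_S k_S` maps the
side `k_S S` onto the side `S`. -/
def pairingGroup (k : Fin 3 → Fin 8) : Subgroup OPlus :=
  Subgroup.closure {g | ∃ (p : Fin 3) (ε δ : ℤˣ), g = sideRefl p ε δ * kElt (k p)}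

/-- The quotient space `H3 / Γ`, with the quotient topology. -/
abbrev HQuot (Γ : Subgroup OPlus) : Type := Quotient (MulAction.orbitRel Γ H3)

/-- The projection `H3 → H3 / Γ`. -/
def proj (Γ : Subgroup OPlus) (x : H3) : HQuot Γ := Quotient.mk (MulAction.orbitRel Γ H3) x

/-- The hyperbolic 3-manifold obtained from `Q³` by the side pairing with code `k`. -/
abbrev CensusManifold (k : Fin 3 → Fin 8) : Type := HQuot (pairingGroup k)

/-- The subgroup of orientation-preserving elements of the group of the census manifold. -/
def pairingGroupPlus (k : Fin 3 → Fin 8) : Subgroup OPlus := pairingGroup k ⊓ SOPlus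

/-- The orientable double cover of a non-orientable census manifold: the quotient of `H3` by the
orientation-preserving elements of its group. -/
abbrev CensusDoubleCover (k : Fin 3 → Fin 8) : Type := HQuot (pairingGroupPlus k)

/-! ### Totally geodesic surfaces -/

/-- Totally geodesic planes of `H3`: the non-empty sets `{x | ⟨x, n⟩ = 0}` with `n` spacelike. -/
def IsGeodesicPlane (P : Set H3) : Prop :=
  ∃ n : Fin 4 → ℝ, 0 < lor n n ∧ P = {x | lor x.1 n = 0}

/-- `S` is a closed (compact, without boundary) embedded totally geodesic surface in `H3 / Γ`,
where `Γ` is discrete and torsion-free (so that the projection is a local isometry): a non-empty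
compact subset which, in the local charts given by the projection, coincides near each of its
points with a totally geodesic plane of `H3`. The surface may be one-sided or non-orientable, and
it is not required to be connected (each component of such a set is again such a set). -/
def IsClosedEmbeddedTotallyGeodesicSurface (Γ : Subgroup OPlus) (S : Set (HQuot Γ)) : Prop :=
  S.Nonempty ∧ IsCompact S ∧
    ∀ x : H3, proj Γ x ∈ S → ∃ P : Set H3, IsGeodesicPlane P ∧ x ∈ P ∧
      ∃ U : Set H3, IsOpen U ∧ x ∈ U ∧ ∀ y ∈ U, proj Γ y ∈ S ↔ y ∈ P

end CensusHyp

end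

open Topology

noncomputable section

namespace CensusHyp

/-! ### The Lorentzian form -/

/-! Put a cusp at infinity in the upper half-space. A geodesic plane that misses the cusp is a
hemisphere, and parabolic elements fixing the cusp translate it. An embedded surface lifts to planes
that are pairwise disjoint or equal, so a hemisphere that is large compared with such a translation
cannot occur. The proof finds a hemisphere that is too large.

Cusps are represented by future null integer vectors `c`. A plane with unit normal `n` rises the
higher into `c` the smaller `|lor n c|` is. Compactness of the surface gives a plane and a cusp for
which this number is minimal and nonzero (`exists_normal`). Rescaling to `lor N c = -1` makes `R =
lor N N` the squared radius of the hemisphere, and `Admissible` records disjointness and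
extremality. Only elements of Γ⁺ are used for disjointness, so the manifold and its double cover are
treated together.

The reflections in the sides of Q³ and in the coordinate planes normalize Γ⁺ and preserve the
integer lattice, so they act on admissible vectors. They carry `c` to an ideal vertex of Q³ and the
centre `(a, b)` of the hemisphere into the unit square (`exists_normalized`). Extremality against
the six ideal vertices then gives `R ≥ 3` (`region_of_one_le_abs`).

A translation `g` of length ℓ at the cusp satisfies `lor N (act g N) = R - ℓ²/2`, so disjointness
forces `R ≤ ℓ²/4`. For each code and each vertex, one pairing or a product of two gives ℓ² = 4, 8 or
16. The first two values contradict `R ≥ 3`. The last leaves `R ≤ 4`, which is excluded by a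
translation at another ideal vertex and, for code 537, one further cusp. -/

theorem lor_comm (x y : Fin 4 → ℝ) : lor x y = lor y x := by simp only [lor]; ring

theorem lor_add_left (x y z : Fin 4 → ℝ) : lor (x + y) z = lor x z + lor y z := by
  simp only [lor, Pi.add_apply]; ring

theorem lor_add_right (x y z : Fin 4 → ℝ) : lor x (y + z) = lor x y + lor x z := by
  simp only [lor, Pi.add_apply]; ring

theorem lor_sub_left (x y z : Fin 4 → ℝ) : lor (x - y) z = lor x z - lor y z := by
  simp only [lor, Pi.sub_apply]; ring

theorem lor_sub_right (x y z : Fin 4 → ℝ) : lor x (y - z) = lor x y - lor x z := by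
  simp only [lor, Pi.sub_apply]; ring

theorem lor_smul_left (r : ℝ) (x y : Fin 4 → ℝ) : lor (r • x) y = r * lor x y := by
  simp only [lor, Pi.smul_apply, smul_eq_mul]; ring

theorem lor_smul_right (r : ℝ) (x y : Fin 4 → ℝ) : lor x (r • y) = r * lor x y := by
  simp only [lor, Pi.smul_apply, smul_eq_mul]; ring

/-- Two future causal vectors, one of them timelike, have negative product. -/
theorem lor_neg_of_causal {x y : Fin 4 → ℝ} (hx : lor x x < 0) (hx3 : 0 < x 3)
    (hy : lor y y ≤ 0) (hy3 : 0 < y 3) : lor x y < 0 := by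
  have h1 : x 0 ^ 2 + x 1 ^ 2 + x 2 ^ 2 < x 3 ^ 2 := by simp only [lor] at hx; linarith
  have h2 : y 0 ^ 2 + y 1 ^ 2 + y 2 ^ 2 ≤ y 3 ^ 2 := by simp only [lor] at hy; linarith
  have cs : (x 0 * y 0 + x 1 * y 1 + x 2 * y 2) ^ 2 ≤
      (x 0 ^ 2 + x 1 ^ 2 + x 2 ^ 2) * (y 0 ^ 2 + y 1 ^ 2 + y 2 ^ 2) := by
    nlinarith [sq_nonneg (x 0 * y 1 - x 1 * y 0), sq_nonneg (x 0 * y 2 - x 2 * y 0),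
      sq_nonneg (x 1 * y 2 - x 2 * y 1)]
  have h3 : (x 0 * y 0 + x 1 * y 1 + x 2 * y 2) ^ 2 < (x 3 * y 3) ^ 2 := by
    have hy2 : 0 < y 3 ^ 2 := by positivity
    have : (x 0 ^ 2 + x 1 ^ 2 + x 2 ^ 2) * (y 0 ^ 2 + y 1 ^ 2 + y 2 ^ 2) ≤
        (x 0 ^ 2 + x 1 ^ 2 + x 2 ^ 2) * y 3 ^ 2 :=
      mul_le_mul_of_nonneg_left h2 (by positivity)
    nlinarith
  have := lt_of_abs_lt (abs_lt_of_sq_lt_sq h3 (mul_pos hx3 hy3).le)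
  simp only [lor]
  linarith

/-! ### The linear action of isometries -/

/-- The linear action of an isometry on `ℝ⁴`. -/
def act (g : OPlus) (v : Fin 4 → ℝ) : Fin 4 → ℝ := g.1.1 *ᵥ v

theorem act_mul (g h : OPlus) (v : Fin 4 → ℝ) : act (g * h) v = act g (act h v) := by
  simp [act]

theorem act_one (v : Fin 4 → ℝ) : act 1 v = v := by simp [act]

theorem act_act_inv (g : OPlus) (v : Fin 4 → ℝ) : act g (act g⁻¹ v) = v := by
  rw [← act_mul, mul_inv_cancel, act_one]

theorem act_smul (g : OPlus) (r : ℝ) (v : Fin 4 → ℝ) : act g (r • v) = r • act g v :=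
  Matrix.mulVec_smul _ _ _

theorem lor_act (g : OPlus) (v w : Fin 4 → ℝ) : lor (act g v) (act g w) = lor v w := g.2.1 v w

theorem lor_act_left (g : OPlus) (v w : Fin 4 → ℝ) : lor (act g v) w = lor v (act g⁻¹ w) := by
  rw [← lor_act g v, act_act_inv]

theorem coe_smul (g : OPlus) (x : H3) : (g • x).1 = act g x.1 := rfl

theorem act_lorRefl (s : Fin 4 → ℝ) (hs : lor s s = 1) (v : Fin 4 → ℝ) :
    act (lorRefl s hs) v = v - (2 * lor v s) • s := by
  change reflMatrix s *ᵥ v = _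
  rw [reflMatrix_mulVec]
  rfl

theorem act_sideRefl (p : Fin 3) (ε δ : ℤˣ) (v : Fin 4 → ℝ) :
    act (sideRefl p ε δ) v = v - (2 * lor v (sideNormal p ε δ)) • sideNormal p ε δ :=
  act_lorRefl _ _ _

theorem act_coordRefl (j : Fin 3) (v : Fin 4 → ℝ) :
    act (coordRefl j) v = Function.update v j.castSucc (-v j.castSucc) := by
  rw [coordRefl, act_lorRefl]
  funext i
  fin_cases j <;> fin_cases i <;> simp [lor] <;> ring

theorem act_kElt (m : Fin 8) (v : Fin 4 → ℝ) :
    act (kElt m) v = ![if m.val.testBit 0 then -v 0 else v 0,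
      if m.val.testBit 1 then -v 1 else v 1, if m.val.testBit 2 then -v 2 else v 2, v 3] := by
  rw [kElt, act_mul, act_mul]
  funext i
  split_ifs <;> fin_cases i <;> simp [act_one, act_coordRefl, Function.update]

theorem OPlus_ext {g h : OPlus} (H : ∀ v, act g v = act h v) : g = h := by
  apply Subtype.ext
  apply Units.ext
  exact Matrix.mulVec_injective (funext H)

/-! ### Null integer vectors -/

/-- The integer lattice in `ℝ⁴`. -/
def IsInt (v : Fin 4 → ℝ) : Prop := ∀ i, ∃ m : ℤ, v i = m

/-- Future-pointing null integer vectors; these represent the cusps. -/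
def IsCusp (c : Fin 4 → ℝ) : Prop := IsInt c ∧ lor c c = 0 ∧ 0 < c 3

/-- The isometries that preserve the integer lattice. -/
def intGroup : Subgroup OPlus where
  carrier := {g | ∀ v, IsInt (act g v) ↔ IsInt v}
  one_mem' v := by rw [act_one]
  mul_mem' {g h} hg hh v := by rw [act_mul, hg, hh]
  inv_mem' {g} hg v := by rw [← hg, act_act_inv]

theorem lorRefl_mem_intGroup {s : Fin 4 → ℝ} (hs : lor s s = 1) (h : IsInt s) :
    lorRefl s hs ∈ intGroup := by
  have key : ∀ v, IsInt v → IsInt (act (lorRefl s hs) v) := by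
    intro v hv i
    rw [act_lorRefl]
    choose a ha using h
    choose b hb using hv
    refine ⟨b i - 2 * (b 0 * a 0 + b 1 * a 1 + b 2 * a 2 - b 3 * a 3) * a i, ?_⟩
    simp only [Pi.sub_apply, Pi.smul_apply, smul_eq_mul, lor, ha, hb]
    push_cast
    ring
  intro v
  refine ⟨fun hv => ?_, key v⟩
  have := key _ hv
  have e : act (lorRefl s hs) (act (lorRefl s hs) v) = v := reflMatrix_invol hs v
  rwa [e] at this

theorem isInt_sideNormal (p : Fin 3) (ε δ : ℤˣ) : IsInt (sideNormal p ε δ) := by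
  intro i
  have h0 : ∃ m : ℤ, (0 : ℝ) = m := ⟨0, by simp⟩
  have h1 : ∃ m : ℤ, (1 : ℝ) = m := ⟨1, by simp⟩
  have hu : ∀ η : ℤˣ, ∃ m : ℤ, (((η : ℤˣ) : ℤ) : ℝ) = m := fun η => ⟨η, rfl⟩
  fin_cases p <;> fin_cases i <;> first | exact h0 | exact h1 | exact hu _

theorem sideRefl_mem_intGroup (p : Fin 3) (ε δ : ℤˣ) : sideRefl p ε δ ∈ intGroup :=
  lorRefl_mem_intGroup _ (isInt_sideNormal p ε δ)

theorem coordRefl_mem_intGroup (j : Fin 3) : coordRefl j ∈ intGroup := by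
  refine lorRefl_mem_intGroup _ fun i => ?_
  by_cases h : i = j.castSucc
  · exact ⟨1, by simp [h]⟩
  · exact ⟨0, by simp [h]⟩

theorem kElt_mem (H : Subgroup OPlus) (h : ∀ j, coordRefl j ∈ H) (m : Fin 8) : kElt m ∈ H := by
  unfold kElt
  refine H.mul_mem (H.mul_mem ?_ ?_) ?_ <;> split_ifs <;> first | exact h _ | exact H.one_mem

theorem pairingGroup_le_intGroup (k : Fin 3 → Fin 8) : pairingGroup k ≤ intGroup := by
  rw [pairingGroup, Subgroup.closure_le]
  rintro _ ⟨p, ε, δ, rfl⟩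
  exact intGroup.mul_mem (sideRefl_mem_intGroup p ε δ) (kElt_mem _ coordRefl_mem_intGroup _)

/-- The point `(0, 0, 0, 1)` of `H3`. -/
def origin : H3 := ⟨![0, 0, 0, 1], by simp [lor], by simp⟩

theorem lor_origin (v : Fin 4 → ℝ) : lor v origin.1 = -v 3 := by simp [lor, origin]

theorem IsCusp.lor_neg {c : Fin 4 → ℝ} (hc : IsCusp c) (x : H3) : lor x.1 c < 0 :=
  lor_neg_of_causal (by rw [x.2.1]; norm_num) x.2.2 hc.2.1.le hc.2.2

theorem IsCusp.map {c : Fin 4 → ℝ} (hc : IsCusp c) {g : OPlus} (hg : g ∈ intGroup) :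
    IsCusp (act g c) := by
  refine ⟨(hg c).2 hc.1, by rw [lor_act, hc.2.1], ?_⟩
  have h := hc.lor_neg (g⁻¹ • origin)
  rw [coe_smul, lor_act_left, inv_inv, lor_comm, lor_origin] at h
  linarith

/-! ### Determinants -/

/-- The determinant of an isometry. -/
def detHom : OPlus →* ℝˣ :=
  (Matrix.GeneralLinearGroup.det (n := Fin 4) (R := ℝ)).comp OPlus.subtype

theorem mem_SOPlus {g : OPlus} : g ∈ SOPlus ↔ detHom g = 1 := MonoidHom.mem_ker

theorem detHom_lorRefl (s : Fin 4 → ℝ) (hs : lor s s = 1) : detHom (lorRefl s hs) = -1 := by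
  apply Units.ext
  change (reflMatrix s).det = -1
  have e : reflMatrix s = 1 + Matrix.replicateCol Unit (-(2 : ℝ) • s) *
      Matrix.replicateRow Unit ![s 0, s 1, s 2, -s 3] := by
    rw [reflMatrix, sub_eq_add_neg, ← neg_smul]
    congr 1
    ext i j
    fin_cases j <;> simp [Matrix.mul_apply] <;> ring
  rw [e, Matrix.det_one_add_replicateCol_mul_replicateRow]
  simp only [lor] at hs
  simp [dotProduct, Fin.sum_univ_four]
  linarith

theorem detHom_sideRefl (p : Fin 3) (ε δ : ℤˣ) : detHom (sideRefl p ε δ) = -1 :=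
  detHom_lorRefl _ _

theorem detHom_coordRefl (j : Fin 3) : detHom (coordRefl j) = -1 := detHom_lorRefl _ _

/-! ### The reflections normalize the groups of the census manifolds -/

theorem conj_lorRefl (g : OPlus) (s : Fin 4 → ℝ) (hs : lor s s = 1) (t : Fin 4 → ℝ)
    (ht : lor t t = 1) (h : act g s = t) : g * lorRefl s hs = lorRefl t ht * g := by
  subst h
  refine OPlus_ext fun v => ?_
  rw [act_mul, act_mul, act_lorRefl, act_lorRefl, lor_act]
  simp only [act, Matrix.mulVec_sub, Matrix.mulVec_smul]

theorem coordRefl_mul_self (j : Fin 3) : coordRefl j * coordRefl j = 1 := by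
  refine OPlus_ext fun v => ?_
  rw [act_mul, act_coordRefl, act_coordRefl, act_one]
  simp

theorem coordRefl_mul_comm (i j : Fin 3) :
    coordRefl i * coordRefl j = coordRefl j * coordRefl i := by
  refine OPlus_ext fun v => ?_
  simp only [act_mul, act_coordRefl]
  by_cases h : i = j
  · rw [h]
  · have h' : i.castSucc ≠ j.castSucc := fun e => h (Fin.castSucc_injective _ e)
    rw [Function.update_of_ne h', Function.update_of_ne h'.symm, Function.update_comm h']

theorem coordRefl_mul_kElt (j : Fin 3) (m : Fin 8) :
    coordRefl j * kElt m = kElt m * coordRefl j := by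
  have h : kElt m ∈ Subgroup.centralizer {coordRefl j} := by
    refine kElt_mem _ (fun i => ?_) m
    rw [Subgroup.mem_centralizer_singleton_iff]
    exact coordRefl_mul_comm _ _
  rw [Subgroup.mem_centralizer_singleton_iff] at h
  exact h.symm

theorem act_coordRefl_sideNormal (j p : Fin 3) (ε δ : ℤˣ) :
    ∃ ε' δ' : ℤˣ, act (coordRefl j) (sideNormal p ε δ) = sideNormal p ε' δ' := by
  have key : ∀ ε' δ' : ℤˣ, (Function.update (sideNormal p ε δ) j.castSucc
      (-sideNormal p ε δ j.castSucc) = sideNormal p ε' δ') →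
      act (coordRefl j) (sideNormal p ε δ) = sideNormal p ε' δ' := fun ε' δ' h => by
    rw [act_coordRefl, h]
  have tac : ∀ ε' δ' : ℤˣ, (∀ i, Function.update (sideNormal p ε δ) j.castSucc
      (-sideNormal p ε δ j.castSucc) i = sideNormal p ε' δ' i) →
      ∃ ε' δ' : ℤˣ, act (coordRefl j) (sideNormal p ε δ) = sideNormal p ε' δ' :=
    fun ε' δ' h => ⟨ε', δ', key _ _ (funext h)⟩
  fin_cases p <;> fin_cases j
  · exact tac (-ε) δ fun i => by fin_cases i <;> simp [sideNormal]
  · exact tac ε (-δ) fun i => by fin_cases i <;> simp [sideNormal]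
  · exact tac ε δ fun i => by fin_cases i <;> simp [sideNormal]
  · exact tac (-ε) δ fun i => by fin_cases i <;> simp [sideNormal]
  · exact tac ε δ fun i => by fin_cases i <;> simp [sideNormal]
  · exact tac ε (-δ) fun i => by fin_cases i <;> simp [sideNormal]
  · exact tac ε δ fun i => by fin_cases i <;> simp [sideNormal]
  · exact tac (-ε) δ fun i => by fin_cases i <;> simp [sideNormal]
  · exact tac ε (-δ) fun i => by fin_cases i <;> simp [sideNormal]

/-- The determinant is invariant under conjugation. -/
theorem normalizer_le_normalizer_inf_SOPlus (Γ : Subgroup OPlus) :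
    Subgroup.normalizer (Γ : Set OPlus) ≤
      Subgroup.normalizer ((Γ ⊓ SOPlus : Subgroup OPlus) : Set OPlus) := by
  intro g hg
  rw [Subgroup.mem_normalizer_iff] at hg ⊢
  intro h
  rw [Subgroup.mem_inf, Subgroup.mem_inf, hg h, mem_SOPlus, mem_SOPlus, map_mul, map_mul, map_inv,
    mul_comm (detHom g), mul_inv_cancel_right]

/-- The group of integral isometries that normalize the group of the double cover. -/
def symmGroup (k : Fin 3 → Fin 8) : Subgroup OPlus :=
  intGroup ⊓ Subgroup.normalizer (pairingGroupPlus k : Set OPlus)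

/-- A coordinate reflection commutes with K and permutes the four sides of each class. Since the
code is constant on a class, conjugation permutes the generators. -/
theorem coordRefl_mem_symmGroup (k : Fin 3 → Fin 8) (j : Fin 3) :
    coordRefl j ∈ symmGroup k := by
  refine ⟨coordRefl_mem_intGroup j, normalizer_le_normalizer_inf_SOPlus _
    (Subgroup.normalizer_le_normalizer_closure _ ?_)⟩
  have hinv : (coordRefl j)⁻¹ = coordRefl j := inv_eq_of_mul_eq_one_left (coordRefl_mul_self j)
  have key : ∀ g : OPlus, (∃ (p : Fin 3) (ε δ : ℤˣ), g = sideRefl p ε δ * kElt (k p)) →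
      ∃ (p : Fin 3) (ε δ : ℤˣ), coordRefl j * g * (coordRefl j)⁻¹ =
        sideRefl p ε δ * kElt (k p) := by
    rintro _ ⟨p, ε, δ, rfl⟩
    obtain ⟨ε', δ', h⟩ := act_coordRefl_sideNormal j p ε δ
    refine ⟨p, ε', δ', ?_⟩
    rw [mul_inv_eq_iff_eq_mul, ← mul_assoc, sideRefl, conj_lorRefl _ _ _ _ _ h, mul_assoc,
      coordRefl_mul_kElt, ← mul_assoc]
    rfl
  intro g
  refine ⟨key g, fun h => ?_⟩
  have := key _ h
  rwa [hinv, ← mul_assoc, ← mul_assoc, coordRefl_mul_self, one_mul, mul_assoc,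
    coordRefl_mul_self, mul_one] at this

/-- A side reflection is the pairing `r_S k_S` times the inverse of `k_S`, and both factors
normalize. -/
theorem sideRefl_mem_symmGroup (k : Fin 3 → Fin 8) (p : Fin 3) (ε δ : ℤˣ) :
    sideRefl p ε δ ∈ symmGroup k := by
  refine ⟨sideRefl_mem_intGroup p ε δ, ?_⟩
  have h1 : sideRefl p ε δ * kElt (k p) ∈
      Subgroup.normalizer (pairingGroupPlus k : Set OPlus) :=
    normalizer_le_normalizer_inf_SOPlus _
      (Subgroup.le_normalizer (Subgroup.subset_closure ⟨p, ε, δ, rfl⟩))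
  have h2 := kElt_mem _ (fun j => (coordRefl_mem_symmGroup k j).2) (k p)
  simpa using Subgroup.mul_mem _ h1 (Subgroup.inv_mem _ h2)

/-! ### Admissible normal vectors -/

/-- The properties of a normal vector of a lift of a closed embedded totally geodesic surface,
scaled so that its smallest product with a cusp vector is one. -/
structure Admissible (k : Fin 3 → Fin 8) (N : Fin 4 → ℝ) : Prop where
  pos : 0 < lor N N
  embedded : ∀ g ∈ pairingGroupPlus k, lor N N ≤ |lor N (act g N)|
  cusp : ∀ c, IsCusp c → 1 ≤ |lor N c|

theorem Admissible.map {k : Fin 3 → Fin 8} {N : Fin 4 → ℝ} (h : Admissible k N) {g : OPlus}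
    (hg : g ∈ symmGroup k) : Admissible k (act g N) := by
  refine ⟨by rw [lor_act]; exact h.pos, fun γ hγ => ?_, fun c hc => ?_⟩
  · rw [lor_act, lor_act_left, ← act_mul, ← act_mul]
    have := Subgroup.inv_mem _ hg.2
    rw [Subgroup.mem_normalizer_iff] at this
    have := (this γ).1 hγ
    rw [inv_inv] at this
    simpa only [mul_assoc] using h.embedded _ this
  · rw [lor_act_left]
    exact h.cusp _ (hc.map (Subgroup.inv_mem _ hg.1))

/-! ### Moving the extremal cusp to an ideal vertex and the centre into the unit square -/

/-- The sign choices give `|x| + |y| ≤ t`. Squaring yields `2|x||y| ≤ z² ≤ |x||y|`, so `|x||y|` and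
`z` vanish. -/
theorem eq_zero_of_null_of_add_le {x y z t : ℝ} (ht : 0 < t)
    (he : x * x + y * y + z * z = t * t)
    (hs : ∀ ε δ : ℤˣ, x * (ε : ℤ) + y * (δ : ℤ) ≤ t) (hzx : |z| ≤ |x|) (hzy : |z| ≤ |y|) :
    z = 0 ∧ (x = 0 ∧ |y| = t ∨ y = 0 ∧ |x| = t) := by
  have hxy : |x| + |y| ≤ t := by
    have h1 := hs 1 1
    have h2 := hs 1 (-1)
    have h3 := hs (-1) 1
    have h4 := hs (-1) (-1)
    simp only [Units.val_one, Units.val_neg, Int.cast_one, Int.cast_neg] at h1 h2 h3 h4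
    rcases abs_cases x with ⟨e, _⟩ | ⟨e, _⟩ <;> rcases abs_cases y with ⟨e', _⟩ | ⟨e', _⟩ <;>
      rw [e, e'] <;> linarith
  have hzz : |z| * |z| ≤ |x| * |y| := mul_le_mul hzx hzy (abs_nonneg _) (abs_nonneg _)
  have hsq : (|x| + |y|) * (|x| + |y|) ≤ t * t := mul_self_le_mul_self (by positivity) hxy
  have ex := abs_mul_abs_self x
  have ey := abs_mul_abs_self y
  have ez := abs_mul_abs_self z
  have hxy0 : |x| * |y| = 0 := le_antisymm (by linarith) (by positivity)
  have hz : z = 0 := mul_self_eq_zero.1 (le_antisymm (by linarith) (mul_self_nonneg z))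
  subst hz
  refine ⟨rfl, ?_⟩
  rw [mul_zero, add_zero] at he
  rcases mul_eq_zero.1 hxy0 with h0 | h0
  · left
    have hx : x = 0 := abs_eq_zero.1 h0
    subst hx
    rw [mul_zero, zero_add, mul_self_eq_mul_self_iff, ← abs_eq_abs] at he
    rw [he, abs_of_pos ht]
    exact ⟨rfl, rfl⟩
  · right
    have hy : y = 0 := abs_eq_zero.1 h0
    subst hy
    rw [mul_zero, add_zero, mul_self_eq_mul_self_iff, ← abs_eq_abs] at he
    rw [he, abs_of_pos ht]
    exact ⟨rfl, rfl⟩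

/-- A null integer vector whose product with all side normals is non-positive is a multiple of
an ideal vertex of the rhombic dodecahedron. -/
theorem exists_axis_of_lor_nonpos {c : Fin 4 → ℝ} (hc : IsCusp c)
    (h : ∀ p ε δ, lor c (sideNormal p ε δ) ≤ 0) :
    ∃ i : Fin 3, |c i.castSucc| = c 3 ∧ ∀ j : Fin 3, j ≠ i → c j.castSucc = 0 := by
  have hn : c 0 * c 0 + c 1 * c 1 + c 2 * c 2 - c 3 * c 3 = 0 := hc.2.1
  have h3 := hc.2.2
  have h0 : ∀ ε δ : ℤˣ, c 0 * (ε : ℤ) + c 1 * (δ : ℤ) ≤ c 3 := fun ε δ => by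
    simpa [sideNormal, lor] using h 0 ε δ
  have h1 : ∀ ε δ : ℤˣ, c 0 * (ε : ℤ) + c 2 * (δ : ℤ) ≤ c 3 := fun ε δ => by
    simpa [sideNormal, lor] using h 1 ε δ
  have h2 : ∀ ε δ : ℤˣ, c 1 * (ε : ℤ) + c 2 * (δ : ℤ) ≤ c 3 := fun ε δ => by
    simpa [sideNormal, lor] using h 2 ε δ
  have ax0 : |c 0| = c 3 → c 1 = 0 → c 2 = 0 → ∃ i : Fin 3, |c i.castSucc| = c 3 ∧
      ∀ j : Fin 3, j ≠ i → c j.castSucc = 0 := fun a b d =>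
    ⟨0, a, fun j hj => by fin_cases j; exacts [absurd rfl hj, b, d]⟩
  have ax1 : |c 1| = c 3 → c 0 = 0 → c 2 = 0 → ∃ i : Fin 3, |c i.castSucc| = c 3 ∧
      ∀ j : Fin 3, j ≠ i → c j.castSucc = 0 := fun a b d =>
    ⟨1, a, fun j hj => by fin_cases j; exacts [b, absurd rfl hj, d]⟩
  have ax2 : |c 2| = c 3 → c 0 = 0 → c 1 = 0 → ∃ i : Fin 3, |c i.castSucc| = c 3 ∧
      ∀ j : Fin 3, j ≠ i → c j.castSucc = 0 := fun a b d =>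
    ⟨2, a, fun j hj => by fin_cases j; exacts [b, d, absurd rfl hj]⟩
  have m2 (hx : |c 2| ≤ |c 0|) (hy : |c 2| ≤ |c 1|) : ∃ i : Fin 3, |c i.castSucc| = c 3 ∧
      ∀ j : Fin 3, j ≠ i → c j.castSucc = 0 := by
    obtain ⟨hz, ⟨hx, hy⟩ | ⟨hx, hy⟩⟩ := eq_zero_of_null_of_add_le h3 (by linarith) h0 hx hy
    · exact ax1 hy hx hz
    · exact ax0 hy hx hz
  rcases le_total |c 0| |c 1| with h01 | h01
  · rcases le_total |c 0| |c 2| with h02 | h02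
    · obtain ⟨hz, ⟨hx, hy⟩ | ⟨hx, hy⟩⟩ :=
        eq_zero_of_null_of_add_le h3 (by linarith) h2 h01 h02
      · exact ax2 hy hz hx
      · exact ax1 hy hz hx
    · exact m2 h02 (h02.trans h01)
  · rcases le_total |c 1| |c 2| with h12 | h12
    · obtain ⟨hz, ⟨hx, hy⟩ | ⟨hx, hy⟩⟩ :=
        eq_zero_of_null_of_add_le h3 (by linarith) h1 h01 h12
      · exact ax2 hy hx hz
      · exact ax0 hy hz hx
    · exact m2 (h12.trans h01) h12

/-- Side reflections lower the last coordinate of a cusp vector until it is an ideal vertex of the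
rhombic dodecahedron. -/
theorem exists_lor_vertex {k : Fin 3 → Fin 8} {c : Fin 4 → ℝ} (hc : IsCusp c) {N : Fin 4 → ℝ}
    (hN : Admissible k N) (h : lor N c = -1) :
    ∃ (i : Fin 3) (N' : Fin 4 → ℝ), Admissible k N' ∧ N' 3 - N' i.castSucc = 1 := by
  obtain ⟨m, hm⟩ : ∃ m : ℕ, c 3 < m := exists_nat_gt _
  induction m generalizing c N with
  | zero => exact absurd hc.2.2 (by push_cast at hm; linarith)
  | succ m ih =>
    by_cases hs : ∀ p ε δ, lor c (sideNormal p ε δ) ≤ 0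
    · obtain ⟨i, hi, hj⟩ := exists_axis_of_lor_nonpos hc hs
      have hs3 : (Pi.single i.castSucc 1 + Pi.single 3 1 : Fin 4 → ℝ) 3 = 1 := by
        fin_cases i <;> simp
      have hcusp : IsCusp (Pi.single i.castSucc 1 + Pi.single 3 1) := by
        refine ⟨fun l => ?_, by fin_cases i <;> simp [lor], by rw [hs3]; norm_num⟩
        have h0 : ∃ m : ℤ, (0 : ℝ) = m := ⟨0, by simp⟩
        have h1 : ∃ m : ℤ, (1 : ℝ) = m := ⟨1, by simp⟩
        fin_cases i <;> fin_cases l <;> simp [h0, h1]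
      obtain ⟨g, hg, hgc⟩ : ∃ g ∈ symmGroup k,
          act g c = c 3 • (Pi.single i.castSucc 1 + Pi.single 3 1) := by
        rcases abs_choice (c i.castSucc) with e | e
        · refine ⟨1, Subgroup.one_mem _, ?_⟩
          rw [act_one]
          rw [e] at hi
          funext l
          fin_cases i <;> fin_cases l <;> simp at hi ⊢ <;>
            first | exact hi | exact hj 0 (by decide) |
              exact hj 1 (by decide) | exact hj 2 (by decide)
        · refine ⟨coordRefl i, coordRefl_mem_symmGroup k i, ?_⟩
          rw [act_coordRefl]
          rw [e] at hi
          funext l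
          fin_cases i <;> fin_cases l <;> simp [Function.update] at hi ⊢ <;>
            first | exact hi | exact hj 0 (by decide) |
              exact hj 1 (by decide) | exact hj 2 (by decide)
      have hN' := hN.map hg
      rw [← lor_act g, hgc, lor_smul_right] at h
      set e := lor (act g N) (Pi.single i.castSucc 1 + Pi.single 3 1) with he
      have h1 : 1 ≤ |e| := hN'.cusp _ hcusp
      have h3 : 1 ≤ c 3 := by
        obtain ⟨z, hz⟩ := hc.1 3
        have := hc.2.2
        rw [hz] at this ⊢
        exact_mod_cast this
      have he0 : e < 0 := by
        by_contra hne
        nlinarith [mul_nonneg hc.2.2.le (not_lt.1 hne)]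
      rw [abs_of_neg he0] at h1
      -- Here `c 3 * e = -1` with `c 3 ≥ 1` and `|e| ≥ 1`, so both factors have absolute value one.
      have he1 : e = -1 := by nlinarith
      refine ⟨i, act g N, hN', ?_⟩
      rw [he1] at he
      fin_cases i <;> simp [lor] at he ⊢ <;> linarith
    · push Not at hs
      obtain ⟨p, ε, δ, hs⟩ := hs
      have hm1 := sideRefl_mem_symmGroup k p ε δ
      refine ih (hc.map hm1.1) (hN.map hm1) (by rw [lor_act, h]) ?_
      obtain ⟨a, ha⟩ := (hc.map hm1.1).1 3
      obtain ⟨b, hb⟩ := hc.1 3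
      -- Every side normal has last coordinate 1, so reflecting in a side with `lor c s > 0`
      -- strictly lowers the integer `c 3`.
      have hlt : act (sideRefl p ε δ) c 3 < c 3 := by
        rw [act_sideRefl]
        have : sideNormal p ε δ 3 = 1 := by fin_cases p <;> rfl
        simp only [Pi.sub_apply, Pi.smul_apply, smul_eq_mul, this]
        linarith
      rw [ha, hb] at hlt
      rw [hb] at hm
      rw [ha]
      have h1 : a < b := by exact_mod_cast hlt
      have h2 : b < m + 1 := by exact_mod_cast hm
      exact_mod_cast (by omega : a < m)

theorem exists_sideNormal_eq {i j : Fin 3} (hij : i ≠ j) : ∃ p, sideNormal p 1 1 =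
    Pi.single i.castSucc 1 + Pi.single j.castSucc 1 + Pi.single 3 1 := by
  have key : ∀ p : Fin 3, (∀ l, sideNormal p 1 1 l =
      (Pi.single i.castSucc 1 + Pi.single j.castSucc 1 + Pi.single 3 1 : Fin 4 → ℝ) l) →
      ∃ p, sideNormal p 1 1 =
        Pi.single i.castSucc 1 + Pi.single j.castSucc 1 + Pi.single 3 1 :=
    fun p h => ⟨p, funext h⟩
  fin_cases i <;> fin_cases j <;> first | exact absurd rfl hij | skip
  · exact key 0 fun l => by fin_cases l <;> simp [sideNormal]
  · exact key 1 fun l => by fin_cases l <;> simp [sideNormal]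
  · exact key 0 fun l => by fin_cases l <;> simp [sideNormal]
  · exact key 2 fun l => by fin_cases l <;> simp [sideNormal]
  · exact key 1 fun l => by fin_cases l <;> simp [sideNormal]
  · exact key 2 fun l => by fin_cases l <;> simp [sideNormal]

theorem castSucc_ne_three (i : Fin 3) : i.castSucc ≠ (3 : Fin 4) := (Fin.castSucc_lt_last i).ne

/-- The stabilizer of a cusp in the symmetry group moves each coordinate of the centre of a plane
into the unit interval. -/
theorem Admissible.exists_coord_mem_Icc {k : Fin 3 → Fin 8} {N : Fin 4 → ℝ} (hN : Admissible k N)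
    {i j : Fin 3} (hij : i ≠ j) (h : N 3 - N i.castSucc = 1) :
    ∃ N', Admissible k N' ∧ N' 3 - N' i.castSucc = 1 ∧ N' j.castSucc ∈ Set.Icc (0 : ℝ) 1 ∧
      ∀ l : Fin 3, l ≠ i → l ≠ j → N' l.castSucc = N l.castSucc := by
  have hij' : i.castSucc ≠ j.castSucc := fun e => hij (Fin.castSucc_injective _ e)
  obtain ⟨m, hm⟩ : ∃ m : ℕ, |N j.castSucc| ≤ m + 1 :=
    (exists_nat_ge |N j.castSucc|).imp fun m hm => by linarith
  induction m generalizing N with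
  | zero =>
    rw [Nat.cast_zero, zero_add] at hm
    rcases le_total 0 (N j.castSucc) with h0 | h0
    · exact ⟨N, hN, h, ⟨h0, (le_abs_self _).trans hm⟩, fun _ _ _ => rfl⟩
    · refine ⟨_, hN.map (coordRefl_mem_symmGroup k j), ?_, ?_, fun l _ hl => ?_⟩
      · rw [act_coordRefl, Function.update_of_ne (castSucc_ne_three j).symm,
          Function.update_of_ne hij', h]
      · rw [act_coordRefl, Function.update_self]
        exact ⟨by linarith, (neg_le_abs _).trans hm⟩
      · rw [act_coordRefl, Function.update_of_ne fun e => hl (Fin.castSucc_injective _ e)]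
  | succ m ih =>
    have step : ∀ M, Admissible k M → M 3 - M i.castSucc = 1 → 0 ≤ M j.castSucc →
        M j.castSucc ≤ m + 1 + 1 → ∃ M', Admissible k M' ∧ M' 3 - M' i.castSucc = 1 ∧
        M' j.castSucc ∈ Set.Icc (0 : ℝ) 1 ∧
        ∀ l : Fin 3, l ≠ i → l ≠ j → M' l.castSucc = M l.castSucc := by
      intro M hM hMi h0 hm
      by_cases h1 : M j.castSucc ≤ 1
      · exact ⟨M, hM, hMi, ⟨h0, h1⟩, fun _ _ _ => rfl⟩
      -- This side passes through the cusp, and its reflection sends the `j`-th coordinate `x` to `2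
      -- - x`. Together with `x ↦ -x` it generates an infinite dihedral group with fundamental
      -- interval `[0, 1]`.
      obtain ⟨p, hp⟩ := exists_sideNormal_eq hij
      have hl : lor M (sideNormal p 1 1) = M j.castSucc - 1 := by
        rw [hp]
        trans M j.castSucc - (M 3 - M i.castSucc)
        swap
        · rw [hMi]
        fin_cases i <;> fin_cases j <;> simp [lor] at hij ⊢ <;> ring
      have hc : ∀ l, act (sideRefl p 1 1) M l = M l - 2 * (M j.castSucc - 1) *
          (Pi.single i.castSucc 1 + Pi.single j.castSucc 1 + Pi.single 3 1 : Fin 4 → ℝ) l := by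
        intro l
        rw [act_sideRefl, hl, hp]
        rfl
      have hMj : act (sideRefl p 1 1) M j.castSucc = 2 - M j.castSucc := by
        rw [hc]
        simp [Pi.single_eq_of_ne hij'.symm, Pi.single_eq_of_ne (castSucc_ne_three j)]
        ring
      obtain ⟨M', h1', h2', h3', h4'⟩ := ih (hM.map (sideRefl_mem_symmGroup k p 1 1)) (by
          rw [hc, hc]
          simp [Pi.single_eq_of_ne hij', Pi.single_eq_of_ne (castSucc_ne_three i),
            Pi.single_eq_of_ne (castSucc_ne_three j).symm,
            Pi.single_eq_of_ne (castSucc_ne_three i).symm]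
          linarith) (by
          have : (0 : ℝ) ≤ m := Nat.cast_nonneg m
          rw [hMj, abs_le]
          constructor <;> linarith)
      refine ⟨M', h1', h2', h3', fun l hli hlj => ?_⟩
      rw [h4' l hli hlj, hc]
      simp [Pi.single_eq_of_ne (fun e => hli (Fin.castSucc_injective _ e)),
        Pi.single_eq_of_ne (fun e => hlj (Fin.castSucc_injective _ e)),
        Pi.single_eq_of_ne (castSucc_ne_three l)]
    push_cast at hm
    rcases le_total 0 (N j.castSucc) with h0 | h0
    · exact step N hN h h0 ((le_abs_self _).trans hm)
    · obtain ⟨M', h1', h2', h3', h4'⟩ := step _ (hN.map (coordRefl_mem_symmGroup k j)) (by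
        rw [act_coordRefl, Function.update_of_ne (castSucc_ne_three j).symm,
          Function.update_of_ne hij', h]) (by
        rw [act_coordRefl, Function.update_self]; linarith) (by
        rw [act_coordRefl, Function.update_self]; exact (neg_le_abs _).trans hm)
      refine ⟨M', h1', h2', h3', fun l hli hlj => ?_⟩
      rw [h4' l hli hlj, act_coordRefl,
        Function.update_of_ne fun e => hlj (Fin.castSucc_injective _ e)]

theorem Admissible.exists_normalized {k : Fin 3 → Fin 8} {N c : Fin 4 → ℝ} (hN : Admissible k N)
    (hc : IsCusp c) (h : lor N c = -1) : ∃ (i : Fin 3) (M : Fin 4 → ℝ), Admissible k M ∧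
      M 3 - M i.castSucc = 1 ∧ ∀ j : Fin 3, j ≠ i → M j.castSucc ∈ Set.Icc (0 : ℝ) 1 := by
  obtain ⟨i, N, hN, hi⟩ := exists_lor_vertex hc hN h
  obtain ⟨j, l, hij, hil, hjl, hall⟩ : ∃ j l : Fin 3, i ≠ j ∧ i ≠ l ∧ j ≠ l ∧
      ∀ m, m ≠ i → m = j ∨ m = l :=
    (by decide : ∀ i : Fin 3, ∃ j l : Fin 3, i ≠ j ∧ i ≠ l ∧ j ≠ l ∧
      ∀ m, m ≠ i → m = j ∨ m = l) i
  obtain ⟨N₁, h1, h1i, h1j, -⟩ := hN.exists_coord_mem_Icc hij hi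
  obtain ⟨N₂, h2, h2i, h2l, h2⟩ := h1.exists_coord_mem_Icc hil h1i
  refine ⟨i, N₂, ‹_›, h2i, fun m hm => ?_⟩
  rcases hall m hm with rfl | rfl
  · rwa [h2 m hm hjl]
  · exact h2l

theorem Admissible.one_le_abs_sub {k : Fin 3 → Fin 8} {N : Fin 4 → ℝ} (hN : Admissible k N)
    (j : Fin 3) : 1 ≤ |N j.castSucc - N 3| ∧ 1 ≤ |-N j.castSucc - N 3| := by
  have h0 : ∃ m : ℤ, (0 : ℝ) = m := ⟨0, by simp⟩
  have h1 : ∃ m : ℤ, (1 : ℝ) = m := ⟨1, by simp⟩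
  have h2 : ∃ m : ℤ, (-1 : ℝ) = m := ⟨-1, by simp⟩
  constructor
  · have := hN.cusp (Pi.single j.castSucc 1 + Pi.single 3 1)
      ⟨fun l => by fin_cases j <;> fin_cases l <;> simp [h0, h1],
        by fin_cases j <;> simp [lor], by fin_cases j <;> simp⟩
    fin_cases j <;> simpa [lor] using this
  · have := hN.cusp (Pi.single j.castSucc (-1) + Pi.single 3 1)
      ⟨fun l => by fin_cases j <;> fin_cases l <;> simp [h0, h1, h2],
        by fin_cases j <;> simp [lor], by fin_cases j <;> simp⟩
    fin_cases j <;> simpa [lor] using this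

/-! ### Inequalities for the centre and radius of the hemisphere -/

/-- The coordinates of the normal vector of a plane that has maximal height above a cusp. -/
def Region (a b u : ℝ) : Prop :=
  0 ≤ a ∧ 0 ≤ b ∧ (u ≤ -3 - 2 * a ∧ u ≤ -3 - 2 * b ∨ a = 1 ∧ b = 1 ∧ u = -1)

/-- Positivity of the squared radius rules out `t ≥ a + 1` and `t ≥ b + 1`. At the opposite
vertices, the alternative `t ≥ 1 - a` (or `t ≥ 1 - b`) is compatible with this only at the isolated
point `a = b = 1`, `t = 0`. -/
theorem region_of_one_le_abs {a b t : ℝ} (ha : a ∈ Set.Icc (0 : ℝ) 1) (hb : b ∈ Set.Icc (0 : ℝ) 1)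
    (hpos : 0 < a ^ 2 + b ^ 2 - (2 * t - 1)) (ha1 : 1 ≤ |a - t|) (ha2 : 1 ≤ |-a - t|)
    (hb1 : 1 ≤ |b - t|) (hb2 : 1 ≤ |-b - t|) : Region a b (2 * t - 1) := by
  obtain ⟨ha0, ha⟩ := ha
  obtain ⟨hb0, hb⟩ := hb
  have ha1' : t ≤ a - 1 := by
    rcases le_abs.1 ha1 with h | h
    · linarith
    · nlinarith
  have hb1' : t ≤ b - 1 := by
    rcases le_abs.1 hb1 with h | h
    · linarith
    · nlinarith
  refine ⟨ha0, hb0, ?_⟩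
  rcases le_abs.1 ha2 with h | h <;> rcases le_abs.1 hb2 with h' | h'
  · left; constructor <;> linarith
  · right; refine ⟨?_, ?_, ?_⟩ <;> linarith
  · right; refine ⟨?_, ?_, ?_⟩ <;> linarith
  · right; refine ⟨?_, ?_, ?_⟩ <;> linarith

theorem detHom_kElt (m : Fin 8) : detHom (kElt m) = (if m.val.testBit 0 then -1 else 1) *
    (if m.val.testBit 1 then -1 else 1) * (if m.val.testBit 2 then -1 else 1) := by
  rw [kElt, map_mul, map_mul]
  congr 2 <;> split_ifs <;> simp [detHom_coordRefl]

theorem Admissible.le_abs_lor_pairing {k : Fin 3 → Fin 8} {N : Fin 4 → ℝ} (hN : Admissible k N)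
    (p : Fin 3) (ε δ : ℤˣ) (hd : detHom (kElt (k p)) = -1) :
    lor N N ≤ |lor N (act (sideRefl p ε δ) (act (kElt (k p)) N))| := by
  rw [← act_mul]
  refine hN.embedded _ ⟨Subgroup.subset_closure ⟨p, ε, δ, rfl⟩, mem_SOPlus.2 ?_⟩
  rw [map_mul, hd, detHom_sideRefl, neg_mul_neg, one_mul]

/-- Needed where the available pairings reverse orientation, or where a single one is not a
translation at the cusp. -/
theorem Admissible.le_abs_lor_pairing_mul {k : Fin 3 → Fin 8} {N : Fin 4 → ℝ}
    (hN : Admissible k N) (p : Fin 3) (ε δ : ℤˣ) (q : Fin 3) (ε' δ' : ℤˣ)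
    (hd : detHom (kElt (k p)) * detHom (kElt (k q)) = 1) :
    lor N N ≤ |lor N (act (sideRefl p ε δ) (act (kElt (k p))
      (act (sideRefl q ε' δ') (act (kElt (k q)) N))))| := by
  rw [← act_mul, ← act_mul, ← act_mul, mul_assoc (sideRefl p ε δ * kElt (k p))]
  refine hN.embedded _ ⟨Subgroup.mul_mem _ (Subgroup.subset_closure ⟨p, ε, δ, rfl⟩)
    (Subgroup.subset_closure ⟨q, ε', δ', rfl⟩), mem_SOPlus.2 ?_⟩
  rw [map_mul, map_mul, map_mul, detHom_sideRefl, detHom_sideRefl, mul_mul_mul_comm, hd]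
  simp

/-- A translation of length 2 would force `R ≤ 1`, while `R ≥ 3` on the region. -/
theorem not_region_of_le_abs_sub_two {a b u : ℝ} (hr : Region a b u)
    (h : a ^ 2 + b ^ 2 - u ≤ |a ^ 2 + b ^ 2 - u - 2|) : False := by
  obtain ⟨ha, hb, ⟨h1, h2⟩ | ⟨rfl, rfl, rfl⟩⟩ := hr
  · rcases le_abs.1 h with h | h <;> nlinarith
  · norm_num at h

theorem not_region_of_le_abs_sub_four {a b u : ℝ} (hr : Region a b u)
    (h : a ^ 2 + b ^ 2 - u ≤ |a ^ 2 + b ^ 2 - u - 4|) : False := by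
  obtain ⟨ha, hb, ⟨h1, h2⟩ | ⟨rfl, rfl, rfl⟩⟩ := hr
  · rcases le_abs.1 h with h | h <;> nlinarith
  · norm_num at h

/-- The first inequality comes from a translation of length 4 and gives `R ≤ 4`. The second comes
from a translation at the ideal vertex opposite in the direction of `a`, whose product with the
normal is `τ/2` for `τ = -(u + 2a + 1)`. Since `R = (a+1)² + b² + τ`, it follows that `2 ≤ τ ≤ 3`,
whereas the second inequality needs `τ² ≥ 4R ≥ 4 + 4τ`. -/
theorem not_region_of_le_abs_sub_eight {a b u : ℝ} (hr : Region a b u)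
    (h : a ^ 2 + b ^ 2 - u ≤ |a ^ 2 + b ^ 2 - u - 8|)
    (h' : a ^ 2 + b ^ 2 - u ≤ |a ^ 2 + b ^ 2 - u - (u + 2 * a + 1) ^ 2 / 2|) : False := by
  obtain ⟨ha, hb, ⟨h1, h2⟩ | ⟨rfl, rfl, rfl⟩⟩ := hr
  · have h8 : a ^ 2 + b ^ 2 - u ≤ 4 := by rcases le_abs.1 h with h | h <;> linarith
    have ht : 2 ≤ -(u + 2 * a + 1) := by linarith
    have ht4 : -(u + 2 * a + 1) ≤ 3 := by nlinarith
    rcases le_abs.1 h' with h | h <;> nlinarith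
  · norm_num at h'

/-- The translation at the opposite vertex is now longer by a factor √2, so only `τ² ≥ 2R` follows.
A small range of hemispheres survives, and these contradict extremality at the cusp behind `hc`. -/
theorem not_region_of_le_abs_sub_eight' {a b u : ℝ} (hr : Region a b u)
    (h : a ^ 2 + b ^ 2 - u ≤ |a ^ 2 + b ^ 2 - u - 8|)
    (h' : a ^ 2 + b ^ 2 - u ≤ |a ^ 2 + b ^ 2 - u - (u + 2 * a + 1) ^ 2|)
    (hc : 1 ≤ |2 * a + b - u / 2 - 5 / 2|) : False := by
  obtain ⟨ha, hb, ⟨h1, h2⟩ | ⟨rfl, rfl, rfl⟩⟩ := hr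
  · have h8 : a ^ 2 + b ^ 2 - u ≤ 4 := by rcases le_abs.1 h with h | h <;> linarith
    have ht : 2 ≤ -(u + 2 * a + 1) := by linarith
    obtain ⟨t, rfl⟩ : ∃ t, u = -1 - 2 * a - t := ⟨-(u + 2 * a + 1), by ring⟩
    have ht2 : 2 ≤ t := by linarith
    have hq : (a + 1) ^ 2 + b ^ 2 + t ≤ 4 := by linarith
    have ht3 : t ≤ 3 := by nlinarith
    rcases le_abs.1 h' with h | h
    · nlinarith
    · have h6 : 2 * ((a + 1) ^ 2 + b ^ 2) + 2 * t ≤ t ^ 2 := by linarith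
      -- `t² - 2t ≥ 2` gives `t ≥ 1 + √3`. With `R ≤ 4` this pins `a` and `b` near zero.
      have ht5 : 27 / 10 ≤ t := by nlinarith
      have ha5 : a ≤ 3 / 20 := by nlinarith
      have hb5 : b ≤ 6 / 10 := by nlinarith
      rcases le_abs.1 hc with h | h <;> linarith
  · norm_num at h'

/-! ### Side pairings in coordinates -/

theorem lor_vec (a b c d a' b' c' d' : ℝ) :
    lor ![a, b, c, d] ![a', b', c', d'] = a * a' + b * b' + c * c' - d * d' := rfl

theorem act_sideRefl_zero (ε δ : ℤˣ) (a b c d : ℝ) : act (sideRefl 0 ε δ) ![a, b, c, d] =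
    ![a - 2 * (a * (ε : ℤ) + b * (δ : ℤ) - d) * (ε : ℤ),
      b - 2 * (a * (ε : ℤ) + b * (δ : ℤ) - d) * (δ : ℤ), c,
      d - 2 * (a * (ε : ℤ) + b * (δ : ℤ) - d)] := by
  rw [act_sideRefl]
  funext l
  fin_cases l <;> simp [sideNormal, lor]

theorem act_sideRefl_one (ε δ : ℤˣ) (a b c d : ℝ) : act (sideRefl 1 ε δ) ![a, b, c, d] =
    ![a - 2 * (a * (ε : ℤ) + c * (δ : ℤ) - d) * (ε : ℤ), b,
      c - 2 * (a * (ε : ℤ) + c * (δ : ℤ) - d) * (δ : ℤ),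
      d - 2 * (a * (ε : ℤ) + c * (δ : ℤ) - d)] := by
  rw [act_sideRefl]
  funext l
  fin_cases l <;> simp [sideNormal, lor]

theorem act_sideRefl_two (ε δ : ℤˣ) (a b c d : ℝ) : act (sideRefl 2 ε δ) ![a, b, c, d] =
    ![a, b - 2 * (b * (ε : ℤ) + c * (δ : ℤ) - d) * (ε : ℤ),
      c - 2 * (b * (ε : ℤ) + c * (δ : ℤ) - d) * (δ : ℤ),
      d - 2 * (b * (ε : ℤ) + c * (δ : ℤ) - d)] := by
  rw [act_sideRefl]
  funext l
  fin_cases l <;> simp [sideNormal, lor]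

theorem act_kElt_vec (m : Fin 8) (a b c d : ℝ) : act (kElt m) ![a, b, c, d] =
    ![if m.val.testBit 0 then -a else a, if m.val.testBit 1 then -b else b,
      if m.val.testBit 2 then -c else c, d] := act_kElt _ _

theorem Region.symm {a b u : ℝ} (h : Region a b u) : Region b a u :=
  ⟨h.2.1, h.1, h.2.2.imp And.symm fun h => ⟨h.2.1, h.1, h.2.2⟩⟩

theorem isInt_vec (a b c d : ℕ) : IsInt ![(a : ℝ), b, c, d] := by
  intro i
  fin_cases i
  exacts [⟨a, by simp⟩, ⟨b, by simp⟩, ⟨c, by simp⟩, ⟨d, by simp⟩]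

theorem exists_coords {i : Fin 3} {N : Fin 4 → ℝ} (hi : N 3 - N i.castSucc = 1)
    (hr : ∀ j l : Fin 3, j < l → j ≠ i → l ≠ i →
      Region (N j.castSucc) (N l.castSucc) (2 * N 3 - 1)) :
    ∃ a b t : ℝ, (i = 0 ∧ N = ![t - 1, a, b, t] ∧ Region a b (2 * t - 1)) ∨
      (i = 1 ∧ N = ![a, t - 1, b, t] ∧ Region a b (2 * t - 1)) ∨
      (i = 2 ∧ N = ![a, b, t - 1, t] ∧ Region a b (2 * t - 1)) := by
  have e : N i.castSucc = N 3 - 1 := by linarith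
  have hv : N = ![N 0, N 1, N 2, N 3] := by funext l; fin_cases l <;> rfl
  fin_cases i
  · refine ⟨N 1, N 2, N 3, Or.inl ⟨rfl, ?_, hr 1 2 (by decide) (by decide) (by decide)⟩⟩
    rw [← e]; exact hv
  · refine ⟨N 0, N 2, N 3, Or.inr (Or.inl
      ⟨rfl, ?_, hr 0 2 (by decide) (by decide) (by decide)⟩)⟩
    rw [← e]; exact hv
  · refine ⟨N 0, N 1, N 3, Or.inr (Or.inr
      ⟨rfl, ?_, hr 0 1 (by decide) (by decide) (by decide)⟩)⟩
    rw [← e]; exact hv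

/-! ### The five codes -/

/-- Digits 5 and 3 have determinant one, so their pairings reverse orientation and are used in
products of two. An element of K may swap a vertex with its antipode; each side is chosen through
the image vertex, so that the product fixes the cusp and translates there. The same principle
selects the sides for the other codes. -/
theorem not_admissible_537 {i : Fin 3} {N : Fin 4 → ℝ} (hN : Admissible ![5, 3, 7] N)
    (hi : N 3 - N i.castSucc = 1)
    (hr : ∀ j l : Fin 3, j < l → j ≠ i → l ≠ i →
      Region (N j.castSucc) (N l.castSucc) (2 * N 3 - 1)) : False := by
  obtain ⟨a, b, t, ⟨rfl, rfl, h⟩ | ⟨rfl, rfl, h⟩ | ⟨rfl, rfl, h⟩⟩ := exists_coords hi hr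
  · refine not_region_of_le_abs_sub_four h ?_
    convert hN.le_abs_lor_pairing_mul 0 1 (-1) 1 (-1) 1 (by simp +decide [detHom_kElt]) using 2 <;>
      simp +decide [lor_vec, act_sideRefl_zero, act_sideRefl_one, act_kElt_vec] <;> ring
  · refine not_region_of_le_abs_sub_eight' h ?_ ?_ ?_
    · convert hN.le_abs_lor_pairing_mul 0 1 1 0 1 1 (by simp +decide [detHom_kElt]) using 2 <;>
        simp +decide [lor_vec, act_sideRefl_zero, act_kElt_vec] <;> ring
    · convert hN.le_abs_lor_pairing_mul 0 (-1) (-1) 1 1 1 (by simp +decide [detHom_kElt]) using 2 <;>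
        simp +decide [lor_vec, act_sideRefl_zero, act_sideRefl_one, act_kElt_vec] <;> ring
    · convert hN.cusp ![2, 2, 1, 3] ⟨by simpa using isInt_vec 2 2 1 3,
        by norm_num [lor_vec], by simp⟩ using 2
      rw [lor_vec]
      ring
  · refine not_region_of_le_abs_sub_eight' h ?_ ?_ ?_
    · convert hN.le_abs_lor_pairing_mul 1 1 1 1 1 1 (by simp +decide [detHom_kElt]) using 2 <;>
        simp +decide [lor_vec, act_sideRefl_one, act_kElt_vec] <;> ring
    · convert hN.le_abs_lor_pairing_mul 0 (-1) (-1) 1 1 1 (by simp +decide [detHom_kElt]) using 2 <;>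
        simp +decide [lor_vec, act_sideRefl_zero, act_sideRefl_one, act_kElt_vec] <;> ring
    · convert hN.cusp ![2, 1, 2, 3] ⟨by simpa using isInt_vec 2 1 2 3,
        by norm_num [lor_vec], by simp⟩ using 2
      rw [lor_vec]
      ring

theorem not_admissible_152 {i : Fin 3} {N : Fin 4 → ℝ} (hN : Admissible ![1, 5, 2] N)
    (hi : N 3 - N i.castSucc = 1)
    (hr : ∀ j l : Fin 3, j < l → j ≠ i → l ≠ i →
      Region (N j.castSucc) (N l.castSucc) (2 * N 3 - 1)) : False := by
  obtain ⟨a, b, t, ⟨rfl, rfl, h⟩ | ⟨rfl, rfl, h⟩ | ⟨rfl, rfl, h⟩⟩ := exists_coords hi hr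
  · refine not_region_of_le_abs_sub_eight h ?_ ?_
    · convert hN.le_abs_lor_pairing_mul 0 1 1 0 (-1) (-1) (by simp +decide [detHom_kElt]) using 2 <;>
        simp +decide [lor_vec, act_sideRefl_zero, act_kElt_vec] <;> ring
    · convert hN.le_abs_lor_pairing 0 (-1) (-1) (by simp +decide [detHom_kElt]) using 2 <;>
        simp +decide [lor_vec, act_sideRefl_zero, act_kElt_vec] <;> ring
  · refine not_region_of_le_abs_sub_two h ?_
    convert hN.le_abs_lor_pairing 0 1 1 (by simp +decide [detHom_kElt]) using 2 <;>
      simp +decide [lor_vec, act_sideRefl_zero, act_kElt_vec] <;> ring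
  · refine not_region_of_le_abs_sub_two h ?_
    convert hN.le_abs_lor_pairing 2 1 1 (by simp +decide [detHom_kElt]) using 2 <;>
      simp +decide [lor_vec, act_sideRefl_two, act_kElt_vec] <;> ring

theorem not_admissible_173 {i : Fin 3} {N : Fin 4 → ℝ} (hN : Admissible ![1, 7, 3] N)
    (hi : N 3 - N i.castSucc = 1)
    (hr : ∀ j l : Fin 3, j < l → j ≠ i → l ≠ i →
      Region (N j.castSucc) (N l.castSucc) (2 * N 3 - 1)) : False := by
  obtain ⟨a, b, t, ⟨rfl, rfl, h⟩ | ⟨rfl, rfl, h⟩ | ⟨rfl, rfl, h⟩⟩ := exists_coords hi hr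
  · refine not_region_of_le_abs_sub_four h ?_
    convert hN.le_abs_lor_pairing_mul 0 1 (-1) 1 (-1) (-1) (by simp +decide [detHom_kElt]) using 2 <;>
      simp +decide [lor_vec, act_sideRefl_zero, act_sideRefl_one, act_kElt_vec] <;> ring
  · refine not_region_of_le_abs_sub_two h ?_
    convert hN.le_abs_lor_pairing 0 1 1 (by simp +decide [detHom_kElt]) using 2 <;>
      simp +decide [lor_vec, act_sideRefl_zero, act_kElt_vec] <;> ring
  · refine not_region_of_le_abs_sub_eight h.symm ?_ ?_
    · convert hN.le_abs_lor_pairing_mul 1 1 1 1 1 (-1) (by simp +decide [detHom_kElt]) using 2 <;>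
        simp +decide [lor_vec, act_sideRefl_one, act_kElt_vec] <;> ring
    · convert hN.le_abs_lor_pairing 0 (-1) (-1) (by simp +decide [detHom_kElt]) using 2 <;>
        simp +decide [lor_vec, act_sideRefl_zero, act_kElt_vec] <;> ring

theorem not_admissible_136 {i : Fin 3} {N : Fin 4 → ℝ} (hN : Admissible ![1, 3, 6] N)
    (hi : N 3 - N i.castSucc = 1)
    (hr : ∀ j l : Fin 3, j < l → j ≠ i → l ≠ i →
      Region (N j.castSucc) (N l.castSucc) (2 * N 3 - 1)) : False := by
  obtain ⟨a, b, t, ⟨rfl, rfl, h⟩ | ⟨rfl, rfl, h⟩ | ⟨rfl, rfl, h⟩⟩ := exists_coords hi hr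
  · refine not_region_of_le_abs_sub_eight h ?_ ?_
    · convert hN.le_abs_lor_pairing_mul 0 1 1 0 (-1) (-1) (by simp +decide [detHom_kElt]) using 2 <;>
        simp +decide [lor_vec, act_sideRefl_zero, act_kElt_vec] <;> ring
    · convert hN.le_abs_lor_pairing 0 (-1) (-1) (by simp +decide [detHom_kElt]) using 2 <;>
        simp +decide [lor_vec, act_sideRefl_zero, act_kElt_vec] <;> ring
  · refine not_region_of_le_abs_sub_two h ?_
    convert hN.le_abs_lor_pairing 0 1 1 (by simp +decide [detHom_kElt]) using 2 <;>
      simp +decide [lor_vec, act_sideRefl_zero, act_kElt_vec] <;> ring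
  · refine not_region_of_le_abs_sub_eight h.symm ?_ ?_
    · convert hN.le_abs_lor_pairing_mul 1 1 1 1 1 1 (by simp +decide [detHom_kElt]) using 2 <;>
        simp +decide [lor_vec, act_sideRefl_one, act_kElt_vec] <;> ring
    · convert hN.le_abs_lor_pairing 0 (-1) (-1) (by simp +decide [detHom_kElt]) using 2 <;>
        simp +decide [lor_vec, act_sideRefl_zero, act_kElt_vec] <;> ring

theorem not_admissible_156 {i : Fin 3} {N : Fin 4 → ℝ} (hN : Admissible ![1, 5, 6] N)
    (hi : N 3 - N i.castSucc = 1)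
    (hr : ∀ j l : Fin 3, j < l → j ≠ i → l ≠ i →
      Region (N j.castSucc) (N l.castSucc) (2 * N 3 - 1)) : False := by
  obtain ⟨a, b, t, ⟨rfl, rfl, h⟩ | ⟨rfl, rfl, h⟩ | ⟨rfl, rfl, h⟩⟩ := exists_coords hi hr
  · refine not_region_of_le_abs_sub_eight h ?_ ?_
    · convert hN.le_abs_lor_pairing_mul 0 1 1 0 (-1) (-1) (by simp +decide [detHom_kElt]) using 2 <;>
        simp +decide [lor_vec, act_sideRefl_zero, act_kElt_vec] <;> ring
    · convert hN.le_abs_lor_pairing 0 (-1) (-1) (by simp +decide [detHom_kElt]) using 2 <;>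
        simp +decide [lor_vec, act_sideRefl_zero, act_kElt_vec] <;> ring
  · refine not_region_of_le_abs_sub_two h ?_
    convert hN.le_abs_lor_pairing 0 1 1 (by simp +decide [detHom_kElt]) using 2 <;>
      simp +decide [lor_vec, act_sideRefl_zero, act_kElt_vec] <;> ring
  · refine not_region_of_le_abs_sub_four h ?_
    convert hN.le_abs_lor_pairing_mul 1 1 1 2 1 (-1) (by simp +decide [detHom_kElt]) using 2 <;>
      simp +decide [lor_vec, act_sideRefl_one, act_sideRefl_two, act_kElt_vec] <;> ring

/-- None of the five groups has an admissible normal vector. -/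
theorem Admissible.not_lor_cusp_eq {k : Fin 3 → Fin 8}
    (hk : k = ![5, 3, 7] ∨ k = ![1, 5, 2] ∨ k = ![1, 7, 3] ∨ k = ![1, 3, 6] ∨ k = ![1, 5, 6])
    {N c : Fin 4 → ℝ} (hN : Admissible k N) (hc : IsCusp c) : lor N c ≠ -1 := by
  intro h
  obtain ⟨i, M, hM, hi, hj⟩ := hN.exists_normalized hc h
  have hr : ∀ j l : Fin 3, j < l → j ≠ i → l ≠ i →
      Region (M j.castSucc) (M l.castSucc) (2 * M 3 - 1) := by
    intro j l hjl hji hli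
    refine region_of_one_le_abs (hj j hji) (hj l hli) ?_ (hM.one_le_abs_sub j).1
      (hM.one_le_abs_sub j).2 (hM.one_le_abs_sub l).1 (hM.one_le_abs_sub l).2
    have hpos := hM.pos
    have e : M i.castSucc = M 3 - 1 := by linarith
    have : lor M M = M i.castSucc ^ 2 + M j.castSucc ^ 2 + M l.castSucc ^ 2 - M 3 ^ 2 := by
      fin_cases i <;> fin_cases j <;> fin_cases l <;> simp [lor] at hjl hji hli ⊢ <;> ring
    rw [this, e] at hpos
    linarith
  rcases hk with rfl | rfl | rfl | rfl | rfl
  exacts [not_admissible_537 hM hi hr, not_admissible_152 hM hi hr, not_admissible_173 hM hi hr,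
    not_admissible_136 hM hi hr, not_admissible_156 hM hi hr]

/-! ### Topology of hyperbolic space and its quotients -/

theorem isInducing_coe : IsInducing (fun x : H3 => x.1) := IsInducing.subtypeVal

theorem continuous_coe : Continuous (fun x : H3 => x.1) := isInducing_coe.continuous

theorem abs_coord_le (x : H3) (i : Fin 4) : |x.1 i| ≤ x.1 3 := by
  have h := x.2.1
  have h3 := x.2.2
  simp only [lor] at h
  refine abs_le_of_sq_le_sq ?_ h3.le
  fin_cases i <;> simp <;>
    nlinarith [mul_self_nonneg (x.1 0), mul_self_nonneg (x.1 1), mul_self_nonneg (x.1 2)]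

theorem isClosedEmbedding_coe : IsClosedEmbedding (fun x : H3 => x.1) := by
  refine ⟨IsEmbedding.subtypeVal, ?_⟩
  have : Set.range (fun x : H3 => x.1) = {v | lor v v = -1} ∩ {v | 1 ≤ v 3} := by
    ext v
    constructor
    · rintro ⟨x, rfl⟩
      refine ⟨x.2.1, ?_⟩
      have h := x.2.1
      have h3 := x.2.2
      simp only [lor] at h
      simp only [Set.mem_ofPred_eq]
      nlinarith [mul_self_nonneg (x.1 0), mul_self_nonneg (x.1 1), mul_self_nonneg (x.1 2)]
    · rintro ⟨h, h3⟩
      exact ⟨⟨v, h, zero_lt_one.trans_le h3⟩, rfl⟩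
  rw [this]
  refine IsClosed.inter (isClosed_eq ?_ continuous_const) (isClosed_le continuous_const ?_)
  · simp only [lor]; fun_prop
  · fun_prop

instance : T2Space H3 := isClosedEmbedding_coe.isEmbedding.t2Space

instance : LocallyCompactSpace H3 := isClosedEmbedding_coe.locallyCompactSpace

theorem isCompact_setOf_le (B : ℝ) : IsCompact {x : H3 | x.1 3 ≤ B} := by
  have h : IsCompact (Set.univ.pi fun _ : Fin 4 => Set.Icc (-B) B) :=
    isCompact_univ_pi fun _ => isCompact_Icc
  refine (isClosedEmbedding_coe.isCompact_preimage h).of_isClosed_subset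
    (isClosed_le ((continuous_apply 3).comp continuous_coe) continuous_const) ?_
  intro x hx i _
  exact abs_le.1 ((abs_coord_le x i).trans hx)

theorem exists_coord_bound {K : Set H3} (hK : IsCompact K) :
    ∃ B : ℝ, ∀ x ∈ K, x.1 3 ≤ B := by
  obtain ⟨B, hB⟩ := (hK.image ((continuous_apply 3).comp continuous_coe)).bddAbove
  exact ⟨B, fun x hx => hB ⟨x, hx, rfl⟩⟩

instance : ContinuousConstSMul OPlus H3 where
  continuous_const_smul g := by
    rw [isInducing_coe.continuous_iff]
    exact (Continuous.matrix_mulVec continuous_const continuous_coe)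

instance (Γ : Subgroup OPlus) : ContinuousConstSMul Γ H3 where
  continuous_const_smul g := continuous_const_smul (g : OPlus)

/-- A future causal vector is bounded in terms of its product with a point of `H3`. -/
theorem coord_le_of_causal {v : Fin 4 → ℝ} (hv : lor v v ≤ 0) (hv3 : 0 < v 3) (y : H3) :
    v 3 ≤ 2 * y.1 3 * -lor v y.1 := by
  have hy := y.2.1
  have hy3 := y.2.2
  set z := y.1 with hz
  have h1 : v 0 ^ 2 + v 1 ^ 2 + v 2 ^ 2 ≤ v 3 ^ 2 := by simp only [lor] at hv; linarith
  have h2 : z 0 ^ 2 + z 1 ^ 2 + z 2 ^ 2 = z 3 ^ 2 - 1 := by simp only [lor] at hy; linarith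
  have cs : (v 0 * z 0 + v 1 * z 1 + v 2 * z 2) ^ 2 ≤
      (v 0 ^ 2 + v 1 ^ 2 + v 2 ^ 2) * (z 0 ^ 2 + z 1 ^ 2 + z 2 ^ 2) := by
    nlinarith [sq_nonneg (v 0 * z 1 - v 1 * z 0), sq_nonneg (v 0 * z 2 - v 2 * z 0),
      sq_nonneg (v 1 * z 2 - v 2 * z 1)]
  have hge : 0 ≤ z 3 ^ 2 - 1 := by rw [← h2]; positivity
  have hle : (v 0 ^ 2 + v 1 ^ 2 + v 2 ^ 2) * (z 0 ^ 2 + z 1 ^ 2 + z 2 ^ 2) ≤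
      v 3 ^ 2 * (z 3 ^ 2 - 1) := by
    rw [h2]; exact mul_le_mul_of_nonneg_right h1 hge
  have hkey : (2 * z 3 * (v 0 * z 0 + v 1 * z 1 + v 2 * z 2)) ^ 2 ≤
      (v 3 * (2 * z 3 ^ 2 - 1)) ^ 2 := by
    have : (2 * z 3) ^ 2 * (v 0 * z 0 + v 1 * z 1 + v 2 * z 2) ^ 2 ≤
        (2 * z 3) ^ 2 * (v 3 ^ 2 * (z 3 ^ 2 - 1)) :=
      mul_le_mul_of_nonneg_left (cs.trans hle) (by positivity)
    nlinarith [sq_nonneg (v 3)]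
  have := le_of_abs_le (abs_le_of_sq_le_sq hkey (mul_nonneg hv3.le (by linarith)))
  simp only [lor]
  linarith

/-! ### Discreteness and the quotient -/

theorem act_origin_le {g : OPlus} {x y : H3} (h : g • x = y) :
    act g origin.1 3 ≤ 2 * x.1 3 * y.1 3 := by
  have h1 := coord_le_of_causal (v := act g origin.1)
    (by rw [lor_act, origin.2.1]; norm_num) ((g • origin).2.2) y
  rw [← h, coe_smul, lor_act, lor_comm, lor_origin, neg_neg] at h1
  rw [← h, coe_smul]
  linarith

/-- The last entries of the columns are, up to sign, coordinates of `g⁻¹ • origin`, which has the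
same height as `g • origin`. Each column has Lorentz norm at most 1, so all entries are bounded
integers. -/
theorem finite_setOf_act_origin_le (B : ℝ) :
    {g : OPlus | g ∈ intGroup ∧ act g origin.1 3 ≤ B}.Finite := by
  obtain ⟨M, hM⟩ : ∃ M : ℕ, B + 1 ≤ M := exists_nat_ge _
  have hfin : (Set.univ.pi fun _ : Fin 4 => Set.univ.pi fun _ : Fin 4 =>
      (Int.cast '' Set.Icc (-(M : ℤ)) M : Set ℝ)).Finite :=
    Set.Finite.pi fun _ => Set.Finite.pi fun _ => (Set.finite_Icc _ _).image _
  refine Set.Finite.subset (hfin.preimage (f := fun g : OPlus => (g.1.1 : Fin 4 → Fin 4 → ℝ))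
    fun g _ h _ e => Subtype.ext (Units.ext e)) ?_
  rintro g ⟨hg, hB⟩ i - j -
  have hcol : ∀ i, g.1.1 i j = act g (Pi.single j 1) i := fun i => by simp [act]
  have hint : IsInt (act g (Pi.single j 1)) := by
    rw [hg]
    intro l
    by_cases h : l = j
    · exact ⟨1, by simp [h]⟩
    · exact ⟨0, by simp [h]⟩
  have hw3 : (g⁻¹ • origin).1 3 ≤ B := by
    have := lor_act g (act g⁻¹ origin.1) origin.1
    rw [act_act_inv, lor_origin, lor_comm, lor_origin] at this
    rw [coe_smul]
    linarith
  have h3 : |act g (Pi.single j 1) 3| ≤ B := by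
    have e : act g (Pi.single j 1) 3 = -lor (Pi.single j 1) (g⁻¹ • origin).1 := by
      rw [coe_smul, ← lor_act_left, lor_origin, neg_neg]
    have e' : |lor (Pi.single j 1) (g⁻¹ • origin).1| = |(g⁻¹ • origin).1 j| := by
      fin_cases j <;> simp [lor]
    rw [e, abs_neg, e']
    exact (abs_coord_le _ _).trans hw3
  have hl : lor (act g (Pi.single j 1)) (act g (Pi.single j 1)) ≤ 1 := by
    rw [lor_act]
    fin_cases j <;> simp [lor]
  obtain ⟨z, hz⟩ := hint i
  refine ⟨z, ?_, hz.symm.trans (hcol i).symm⟩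
  have hb : |act g (Pi.single j 1) i| ≤ M := by
    set w := act g (Pi.single j 1)
    have hB0 : 0 ≤ B := (abs_nonneg _).trans h3
    have hs : w 3 ^ 2 ≤ B ^ 2 := sq_le_sq' (abs_le.1 h3).1 (abs_le.1 h3).2
    simp only [lor] at hl
    refine (abs_le_of_sq_le_sq ?_ (by linarith : 0 ≤ B + 1)).trans hM
    fin_cases i <;> simp <;>
      nlinarith [mul_self_nonneg (w 0), mul_self_nonneg (w 1), mul_self_nonneg (w 2)]
  rw [hz] at hb
  exact abs_le.1 (by exact_mod_cast hb)

theorem properlyDiscontinuousSMul_of_le {Γ : Subgroup OPlus} (hΓ : Γ ≤ intGroup) :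
    ProperlyDiscontinuousSMul Γ H3 where
  finite_disjoint_inter_image {K L} hK hL := by
    obtain ⟨B, hB⟩ := exists_coord_bound hK
    obtain ⟨C, hC⟩ := exists_coord_bound hL
    refine Set.Finite.subset ((finite_setOf_act_origin_le (2 * B * C)).preimage
      (f := fun g : Γ => g.1) fun _ _ _ _ e => Subtype.ext e) ?_
    rintro g ⟨y, ⟨x, hx, hxy⟩, hy⟩
    refine ⟨hΓ g.2, (act_origin_le (g := g.1) hxy).trans ?_⟩
    have h1 := hB x hx
    have h2 := hC y hy
    have h3 := x.2.2
    have h4 := y.2.2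
    exact mul_le_mul (by linarith) h2 h4.le (by linarith)

/-- Ensures that a compact surface is closed, hence that its preimage is closed. -/
theorem t2Space_HQuot {Γ : Subgroup OPlus} (hΓ : Γ ≤ intGroup) : T2Space (HQuot Γ) := by
  have := properlyDiscontinuousSMul_of_le hΓ
  infer_instance

theorem continuous_proj (Γ : Subgroup OPlus) : Continuous (proj Γ) := continuous_quotient_mk'

theorem isOpenMap_proj (Γ : Subgroup OPlus) : IsOpenMap (proj Γ) := isOpenMap_quotient_mk'_mul

theorem proj_eq_iff {Γ : Subgroup OPlus} {x y : H3} : proj Γ x = proj Γ y ↔ ∃ g ∈ Γ, g • y = x := by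
  rw [proj, proj, Quotient.eq]
  exact ⟨fun ⟨g, h⟩ => ⟨g.1, g.2, h⟩, fun ⟨g, hg, h⟩ => ⟨⟨g, hg⟩, h⟩⟩

theorem exists_coord_le_of_isCompact {Γ : Subgroup OPlus} {S : Set (HQuot Γ)} (hS : IsCompact S) :
    ∃ B : ℝ, ∀ x : H3, proj Γ x ∈ S → ∃ g ∈ Γ, (g • x).1 3 ≤ B := by
  obtain ⟨n, hn⟩ := hS.elim_directed_cover (fun n : ℕ => proj Γ '' {x : H3 | x.1 3 < n})
    (fun n => isOpenMap_proj Γ _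
      (isOpen_lt ((continuous_apply 3).comp continuous_coe) continuous_const))
    (fun s _ => by
      induction s using Quotient.inductionOn with
      | h x =>
        obtain ⟨n, hn⟩ := exists_nat_gt (x.1 3)
        exact Set.mem_iUnion.2 ⟨n, x, hn, rfl⟩)
    (directed_of_isDirected_le fun m n hmn => Set.image_mono fun x (hx : x.1 3 < m) =>
      hx.trans_le (by exact_mod_cast hmn))
  refine ⟨n, fun x hx => ?_⟩
  obtain ⟨y, hy, hyx⟩ := hn hx
  obtain ⟨g, hg, h⟩ := proj_eq_iff.1 hyx
  exact ⟨g, hg, by rw [h]; exact le_of_lt hy⟩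

/-! ### Planes -/

theorem lor_self_nonneg_of_lor_eq_zero {q : Fin 4 → ℝ} (x : H3) (h : lor x.1 q = 0) :
    0 ≤ lor q q := by
  have hx := x.2.1
  have hx3 := x.2.2
  set z := x.1
  have h2 : z 0 ^ 2 + z 1 ^ 2 + z 2 ^ 2 = z 3 ^ 2 - 1 := by simp only [lor] at hx; linarith
  have cs : (z 0 * q 0 + z 1 * q 1 + z 2 * q 2) ^ 2 ≤
      (z 0 ^ 2 + z 1 ^ 2 + z 2 ^ 2) * (q 0 ^ 2 + q 1 ^ 2 + q 2 ^ 2) := by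
    nlinarith [sq_nonneg (z 0 * q 1 - z 1 * q 0), sq_nonneg (z 0 * q 2 - z 2 * q 0),
      sq_nonneg (z 1 * q 2 - z 2 * q 1)]
  have h3 : z 0 * q 0 + z 1 * q 1 + z 2 * q 2 = z 3 * q 3 := by simp only [lor] at h; linarith
  rw [h2, h3] at cs
  have h4 : 0 ≤ q 0 ^ 2 + q 1 ^ 2 + q 2 ^ 2 := by positivity
  have h5 : z 3 ^ 2 * q 3 ^ 2 ≤ z 3 ^ 2 * (q 0 ^ 2 + q 1 ^ 2 + q 2 ^ 2) := by nlinarith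
  have h6 := le_of_mul_le_mul_left h5 (by positivity)
  simp only [lor]
  linarith

/-- Reversed Cauchy–Schwarz: the component of `w` orthogonal to `x` has non-negative norm. -/
theorem neg_lor_self_le_sq {w : Fin 4 → ℝ} (x : H3) : -lor w w ≤ lor x.1 w ^ 2 := by
  have h := lor_self_nonneg_of_lor_eq_zero (q := w + lor x.1 w • x.1) x (by
    rw [lor_add_right, lor_smul_right, x.2.1]; ring)
  simp only [lor_add_right, lor_smul_right, lor_add_left, lor_smul_left, x.2.1,
    lor_comm w x.1] at h
  linarith

theorem pos_of_lor_neg {v : Fin 4 → ℝ} (hv : lor v v ≤ 0) (x : H3) (h : lor x.1 v < 0) :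
    0 < v 3 := by
  by_contra hneg
  have hx := x.2.1
  have hx3 := x.2.2
  set z := x.1
  have h2 : z 0 ^ 2 + z 1 ^ 2 + z 2 ^ 2 = z 3 ^ 2 - 1 := by simp only [lor] at hx; linarith
  have h1 : v 0 ^ 2 + v 1 ^ 2 + v 2 ^ 2 ≤ v 3 ^ 2 := by simp only [lor] at hv; linarith
  have cs : (z 0 * v 0 + z 1 * v 1 + z 2 * v 2) ^ 2 ≤
      (z 0 ^ 2 + z 1 ^ 2 + z 2 ^ 2) * (v 0 ^ 2 + v 1 ^ 2 + v 2 ^ 2) := by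
    nlinarith [sq_nonneg (z 0 * v 1 - z 1 * v 0), sq_nonneg (z 0 * v 2 - z 2 * v 0),
      sq_nonneg (z 1 * v 2 - z 2 * v 1)]
  have h0 : 0 ≤ z 3 ^ 2 - 1 := by rw [← h2]; positivity
  have h3 : (z 3 ^ 2 - 1) * (v 0 ^ 2 + v 1 ^ 2 + v 2 ^ 2) ≤ (z 3 ^ 2 - 1) * v 3 ^ 2 :=
    mul_le_mul_of_nonneg_left h1 h0
  rw [h2] at cs
  simp only [lor] at h
  have h4 : 0 ≤ z 3 * -v 3 := mul_nonneg hx3.le (by linarith)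
  have h5 : (z 3 * -v 3) ^ 2 < (-(z 0 * v 0 + z 1 * v 1 + z 2 * v 2)) ^ 2 :=
    pow_lt_pow_left₀ (by linarith) h4 (by norm_num)
  nlinarith [sq_nonneg (v 3)]

/-- The central projection of the future cone to the hyperboloid. -/
def normalize (v : Fin 4 → ℝ) : Fin 4 → ℝ := (√(-lor v v))⁻¹ • v

theorem normalize_mem {v : Fin 4 → ℝ} (h : lor v v < 0) (h3 : 0 < v 3) :
    lor (normalize v) (normalize v) = -1 ∧ 0 < normalize v 3 := by
  have hs : 0 < √(-lor v v) := Real.sqrt_pos.2 (by linarith)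
  refine ⟨?_, mul_pos (inv_pos.2 hs) h3⟩
  rw [normalize, lor_smul_left, lor_smul_right]
  have := Real.sq_sqrt (by linarith : 0 ≤ -lor v v)
  field_simp
  linarith

theorem lor_normalize_eq_zero {v n : Fin 4 → ℝ} (h : lor v n = 0) : lor (normalize v) n = 0 := by
  rw [normalize, lor_smul_left, h, mul_zero]

theorem continuous_lor_self : Continuous fun v : Fin 4 → ℝ => lor v v := by
  simp only [lor]; fun_prop

theorem continuousOn_normalize : ContinuousOn normalize {v | lor v v < 0} := by
  have h : ContinuousOn (fun v : Fin 4 → ℝ => (√(-lor v v))⁻¹) {v | lor v v < 0} :=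
    ContinuousOn.inv₀ (Real.continuous_sqrt.comp continuous_lor_self.neg).continuousOn
      fun v hv => (Real.sqrt_pos.2 (neg_pos.2 hv)).ne'
  exact h.smul continuousOn_id

theorem normalize_coe (x : H3) : normalize x.1 = x.1 := by
  rw [normalize, x.2.1]; simp

/-- The plane is the central projection of a convex cone of timelike vectors. -/
theorem isPreconnected_plane (n : Fin 4 → ℝ) : IsPreconnected {x : H3 | lor x.1 n = 0} := by
  rw [← isInducing_coe.isPreconnected_image]
  have hC : Convex ℝ {v : Fin 4 → ℝ | lor v v < 0 ∧ 0 < v 3 ∧ lor v n = 0} := by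
    rintro v ⟨hv, hv3, hvn⟩ w ⟨hw, hw3, hwn⟩ a b ha hb hab
    have hvw := lor_neg_of_causal hv hv3 hw.le hw3
    refine ⟨?_, ?_, ?_⟩
    · simp only [lor_add_right, lor_smul_right, lor_add_left, lor_smul_left, lor_comm w v]
      rcases ha.eq_or_lt with rfl | ha
      · rw [zero_add] at hab
        subst hab
        simpa using hw
      · have h1 : a * (a * lor v v) < 0 := mul_neg_of_pos_of_neg ha (mul_neg_of_pos_of_neg ha hv)
        have h2 : b * (b * lor w w) ≤ 0 :=
          mul_nonpos_of_nonneg_of_nonpos hb (mul_nonpos_of_nonneg_of_nonpos hb hw.le)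
        have h3 : a * (b * lor v w) ≤ 0 :=
          mul_nonpos_of_nonneg_of_nonpos ha.le (mul_nonpos_of_nonneg_of_nonpos hb hvw.le)
        linarith
    · simp only [Pi.add_apply, Pi.smul_apply, smul_eq_mul]
      rcases ha.eq_or_lt with rfl | ha
      · rw [zero_add] at hab
        subst hab
        simpa using hw3
      · have := mul_pos ha hv3
        have := mul_nonneg hb hw3.le
        linarith
    · rw [lor_add_left, lor_smul_left, lor_smul_left, hvn, hwn]
      simp
  convert hC.isPreconnected.image normalize (continuousOn_normalize.mono fun v hv => hv.1) using 1
  ext v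
  constructor
  · rintro ⟨x, hx, rfl⟩
    exact ⟨x.1, ⟨by rw [x.2.1]; norm_num, x.2.2, hx⟩, normalize_coe x⟩
  · rintro ⟨w, ⟨h1, h2, h3⟩, rfl⟩
    exact ⟨⟨normalize w, normalize_mem h1 h2⟩, lor_normalize_eq_zero h3, rfl⟩

/-- If a plane is locally contained in another plane, then so is its linear span. -/
theorem lor_eq_zero_of_local {z : H3} {n n' : Fin 4 → ℝ} {U : Set H3} (hU : IsOpen U) (hz : z ∈ U)
    (hzn : lor z.1 n = 0) (h : ∀ y ∈ U, lor y.1 n = 0 → lor y.1 n' = 0) {v : Fin 4 → ℝ}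
    (hv : lor v n = 0) : lor v n' = 0 := by
  obtain ⟨V, hV, rfl⟩ := isInducing_coe.isOpen_iff.1 hU
  have hcont : Continuous fun t : ℝ => z.1 + t • v := by fun_prop
  have h0 : z.1 + (0 : ℝ) • v = z.1 := by simp
  have e1 : ∀ᶠ t in 𝓝 (0 : ℝ), lor (z.1 + t • v) (z.1 + t • v) < 0 :=
    (continuous_lor_self.comp hcont).continuousAt.eventually_lt continuousAt_const
      (by simp [z.2.1])
  have e2 : ∀ᶠ t in 𝓝 (0 : ℝ), 0 < (z.1 + t • v) 3 :=
    continuousAt_const.eventually_lt ((continuous_apply 3).comp hcont).continuousAt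
      (by simpa using z.2.2)
  have e3 : ∀ᶠ t in 𝓝 (0 : ℝ), normalize (z.1 + t • v) ∈ V := by
    have hn : ContinuousAt normalize (z.1 + (0 : ℝ) • v) := by
      rw [h0]
      exact continuousOn_normalize.continuousAt
        ((isOpen_lt continuous_lor_self continuous_const).mem_nhds
          (by rw [Set.mem_ofPred_eq, z.2.1]; norm_num))
    refine (ContinuousAt.comp (f := fun t : ℝ => z.1 + t • v) hn hcont.continuousAt)
      (hV.mem_nhds ?_)
    change normalize (z.1 + (0 : ℝ) • v) ∈ V
    rw [h0, normalize_coe]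
    exact hz
  obtain ⟨t, ⟨h1, h2, h3⟩, ht⟩ := ((((e1.and (e2.and e3)).filter_mono
    (nhdsWithin_le_nhds (s := {0}ᶜ))).and self_mem_nhdsWithin).exists)
  have hy := h ⟨normalize (z.1 + t • v), normalize_mem h1 h2⟩ h3
    (lor_normalize_eq_zero (by rw [lor_add_left, lor_smul_left, hzn, hv]; simp))
  have hz' := h z hz hzn
  change lor (normalize (z.1 + t • v)) n' = 0 at hy
  rw [normalize, lor_smul_left, lor_add_left z.1 (t • v) n', lor_smul_left, hz', zero_add] at hy
  have hs : (√(-lor (z.1 + t • v) (z.1 + t • v)))⁻¹ ≠ 0 :=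
    (inv_pos.2 (Real.sqrt_pos.2 (by linarith))).ne'
  exact (mul_eq_zero.1 ((mul_eq_zero.1 hy).resolve_left hs)).resolve_left ht

theorem lor_eq_mul_of_forall {n n' : Fin 4 → ℝ} (hn : lor n n = 1)
    (h : ∀ v, lor v n = 0 → lor v n' = 0) (v : Fin 4 → ℝ) : lor v n' = lor v n * lor n n' := by
  have := h (v - lor v n • n) (by rw [lor_sub_left, lor_smul_left, hn]; ring)
  rw [lor_sub_left, lor_smul_left] at this
  linarith

/-! ### Complete planes inside a locally planar set -/

/-- A set that locally is a plane near each of its points. -/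
def IsLocallyPlane (T : Set H3) : Prop :=
  ∀ x ∈ T, ∃ n : Fin 4 → ℝ, lor n n = 1 ∧ lor x.1 n = 0 ∧
    ∃ U : Set H3, IsOpen U ∧ x ∈ U ∧ ∀ y ∈ U, y ∈ T ↔ lor y.1 n = 0

/-- The unit normal vectors of the planes that are contained in a set. -/
def planeNormals (T : Set H3) : Set (Fin 4 → ℝ) :=
  {n | lor n n = 1 ∧ ∀ y : H3, lor y.1 n = 0 → y ∈ T}

theorem IsLocallyPlane.exists_planeNormal {T : Set H3} (hT : IsLocallyPlane T) (hc : IsClosed T)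
    {x : H3} (hx : x ∈ T) : ∃ n ∈ planeNormals T, lor x.1 n = 0 := by
  obtain ⟨n, hn, hxn, U, hU, hxU, hUT⟩ := hT x hx
  refine ⟨n, ⟨hn, ?_⟩, hxn⟩
  set P : Set H3 := {y | lor y.1 n = 0} with hP
  -- Connectedness of the plane `P`: `W` collects the open sets on which `P` stays in `T`, and `W'`
  -- those on which `P` avoids `W`. At a point of `T` near which `P` meets `W`, the local plane of
  -- `T` shares an open piece with `P`, hence agrees with it.
  set W : Set H3 := ⋃₀ {V | IsOpen V ∧ ∀ z ∈ V, lor z.1 n = 0 → z ∈ T} with hW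
  set W' : Set H3 := ⋃₀ {V | IsOpen V ∧ P ∩ V ∩ W = ∅} with hW'
  have hWT : ∀ z ∈ W, lor z.1 n = 0 → z ∈ T := fun z ⟨V, hV, hz⟩ h => hV.2 z hz h
  have hxW : x ∈ W := ⟨U, ⟨hU, fun z hz h => (hUT z hz).2 h⟩, hxU⟩
  have hcover : P ⊆ W ∪ W' := by
    intro y hy
    by_cases hyT : y ∈ T
    · obtain ⟨n', hn', hyn', V, hV, hyV, hVT⟩ := hT y hyT
      by_cases hne : P ∩ V ∩ W = ∅
      · exact Or.inr ⟨V, ⟨hV, hne⟩, hyV⟩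
      · obtain ⟨z, ⟨hzP, hzV⟩, V', hV', hzV'⟩ := Set.nonempty_iff_ne_empty.2 hne
        have hloc : ∀ v, lor v n = 0 → lor v n' = 0 := fun v hv =>
          lor_eq_zero_of_local (hV.inter hV'.1) ⟨hzV, hzV'⟩ hzP
            (fun q hq hqn => (hVT q hq.1).1 (hV'.2 q hq.2 hqn)) hv
        exact Or.inl ⟨V, ⟨hV, fun q hq hqn => (hVT q hq).2 (hloc _ hqn)⟩, hyV⟩
    · refine Or.inr ⟨Tᶜ, ⟨hc.isOpen_compl, ?_⟩, hyT⟩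
      rw [Set.eq_empty_iff_forall_notMem]
      rintro z ⟨⟨hzP, hzT⟩, hzW⟩
      exact hzT (hWT z hzW hzP)
  have hempty : P ∩ (W ∩ W') = ∅ := by
    rw [Set.eq_empty_iff_forall_notMem]
    rintro z ⟨hzP, hzW, V, hV, hzV⟩
    exact Set.eq_empty_iff_forall_notMem.1 hV.2 z ⟨⟨hzP, hzV⟩, hzW⟩
  rcases isPreconnected_iff_subset_of_disjoint.1 (isPreconnected_plane n) W W'
    (isOpen_sUnion fun V hV => hV.1) (isOpen_sUnion fun V hV => hV.1) hcover hempty with h | h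
  · exact fun y hy => hWT y (h hy) hy
  · exact absurd (show x ∈ P ∩ (W ∩ W') from ⟨hxn, hxW, h hxn⟩) (by rw [hempty]; exact id)

/-- Two planes contained in a locally planar set do not cross. -/
theorem IsLocallyPlane.one_le_abs_lor {T : Set H3} (hT : IsLocallyPlane T) {n n' : Fin 4 → ℝ}
    (hn : n ∈ planeNormals T) (hn' : n' ∈ planeNormals T) : 1 ≤ |lor n n'| := by
  by_contra hlt
  rw [not_le, ← sq_lt_one_iff_abs_lt_one] at hlt
  set g := lor n n' with hg
  have hd : 0 < 1 - g ^ 2 := by linarith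
  obtain ⟨hn1, hnT⟩ := hn
  obtain ⟨hn1', hnT'⟩ := hn'
  set p := n 3 with hp
  set q := n' 3 with hq
  have ho := lor_origin
  -- the component of the origin orthogonal to both normals, scaled
  set v : Fin 4 → ℝ := (1 - g ^ 2) • origin.1 + (p - g * q) • n + (q - g * p) • n' with hv
  have hvn : lor v n = 0 := by
    rw [hv, lor_add_left, lor_add_left, lor_smul_left, lor_smul_left, lor_smul_left, hn1,
      lor_comm n' n, ← hg, lor_comm origin.1, ho]
    ring
  have hvn' : lor v n' = 0 := by
    rw [hv, lor_add_left, lor_add_left, lor_smul_left, lor_smul_left, lor_smul_left, hn1',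
      ← hg, lor_comm origin.1, ho]
    ring
  have hvo : lor v origin.1 = -((1 - g ^ 2) + ((p - g * q) * p + (q - g * p) * q)) := by
    rw [hv, lor_add_left, lor_add_left, lor_smul_left, lor_smul_left, lor_smul_left,
      origin.2.1, ho, ho]
    ring
  have hvv : lor v v = (1 - g ^ 2) * lor v origin.1 := by
    conv_lhs => rw [hv]
    rw [lor_add_left, lor_add_left, lor_smul_left, lor_smul_left, lor_smul_left, lor_comm n,
      lor_comm n', hvn, hvn', lor_comm origin.1]
    ring
  have hq0 : 0 ≤ (p - g * q) * p + (q - g * p) * q := by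
    nlinarith [sq_nonneg (p - g * q), sq_nonneg (q - g * p), sq_nonneg q, sq_nonneg p,
      mul_nonneg hd.le (sq_nonneg q), mul_nonneg hd.le (sq_nonneg p)]
  have hneg : lor v origin.1 < 0 := by rw [hvo]; linarith
  have hvv0 : lor v v < 0 := by rw [hvv]; exact mul_neg_of_pos_of_neg hd hneg
  have hv3 : 0 < v 3 := by rw [ho] at hneg; linarith
  set x : H3 := ⟨normalize v, normalize_mem hvv0 hv3⟩ with hx
  have hxn : lor x.1 n = 0 := lor_normalize_eq_zero hvn
  have hxn' : lor x.1 n' = 0 := lor_normalize_eq_zero hvn'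
  -- At the crossing point `T` is a single plane with unit normal `m`. Both planes equal it locally,
  -- so `n` and `n'` each have product ±1 with `m`, which forces `g² = 1`.
  obtain ⟨m, hm, -, U, hU, hxU, hUT⟩ := hT x (hnT x hxn)
  have h1 := lor_eq_mul_of_forall hn1 fun w hw => lor_eq_zero_of_local hU hxU hxn
    (fun y hy hyn => (hUT y hy).1 (hnT y hyn)) hw
  have h2 := lor_eq_mul_of_forall hn1' fun w hw => lor_eq_zero_of_local hU hxU hxn'
    (fun y hy hyn => (hUT y hy).1 (hnT' y hyn)) hw
  have e1 := h1 m
  have e2 := h2 m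
  have e3 := h1 n'
  rw [hm, lor_comm m n] at e1
  rw [hm, lor_comm m n'] at e2
  rw [lor_comm n' n, ← hg] at e3
  rw [e3] at e2
  exact hlt.ne (by linear_combination g ^ 2 * e1 - e2)

/-- A plane comes as close to a cusp as its normal vector allows. -/
theorem exists_neg_lor_lt {n : Fin 4 → ℝ} (hn : lor n n = 1) {x : H3} (hx : lor x.1 n = 0)
    {c : Fin 4 → ℝ} (hc : IsCusp c) {r : ℝ} (hr : |lor n c| < r) :
    ∃ y : H3, lor y.1 n = 0 ∧ -lor y.1 c < r := by
  set g := lor n c with hg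
  set k := -lor x.1 c with hk
  have hk0 : 0 < k := by have := hc.lor_neg x; linarith
  have hr0 : 0 < r := (abs_nonneg _).trans_lt hr
  have hgr : g ^ 2 < r ^ 2 := by
    rw [← sq_abs g]; exact pow_lt_pow_left₀ hr (abs_nonneg _) (by norm_num)
  -- The projection `c - g • n` of `c` has norm `-g²` and may be null. Adding `ε • x` makes it
  -- timelike, and this `ε` makes its product with `c` exactly `-r²`.
  set ε := (r ^ 2 - g ^ 2) / k with hε
  have hε0 : 0 < ε := div_pos (by linarith) hk0
  have hεk : ε * k = r ^ 2 - g ^ 2 := div_mul_cancel₀ _ hk0.ne'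
  set v : Fin 4 → ℝ := c - g • n + ε • x.1 with hv
  have hxc : lor x.1 c = -k := by rw [hk, neg_neg]
  have hvn : lor v n = 0 := by
    rw [hv, lor_add_left, lor_sub_left, lor_smul_left, lor_smul_left, hn, hx, lor_comm c, ← hg]
    ring
  have hvc : lor v c = -r ^ 2 := by
    rw [hv, lor_add_left, lor_sub_left, lor_smul_left, lor_smul_left, hc.2.1, hxc, ← hg]
    linarith
  have hvx : lor v x.1 = -k - ε := by
    rw [hv, lor_add_left, lor_sub_left, lor_smul_left, lor_smul_left, x.2.1, lor_comm c,
      lor_comm n, hx, hxc]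
    ring
  have hvv : lor v v = -(2 * r ^ 2 - g ^ 2 + ε ^ 2) := by
    conv_lhs => rw [hv]
    rw [lor_add_left, lor_sub_left, lor_smul_left, lor_smul_left, lor_comm c, lor_comm n,
      lor_comm x.1, hvn, hvc, hvx]
    linarith
  have hε2 : 0 < ε ^ 2 := by positivity
  have hvv0 : lor v v < 0 := by rw [hvv]; nlinarith
  have hv3 : 0 < v 3 := pos_of_lor_neg hvv0.le x (by rw [lor_comm, hvx]; linarith)
  refine ⟨⟨normalize v, normalize_mem hvv0 hv3⟩, lor_normalize_eq_zero hvn, ?_⟩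
  change -lor (normalize v) c < r
  rw [normalize, lor_smul_left, hvc, mul_neg, neg_neg, inv_mul_lt_iff₀
    (Real.sqrt_pos.2 (by linarith)), sq]
  refine mul_lt_mul_of_pos_right (Real.lt_sqrt_of_sq_lt ?_) hr0
  rw [hvv]
  linarith

theorem finite_setOf_isCusp_le (B : ℝ) : {c | IsCusp c ∧ c 3 ≤ B}.Finite := by
  obtain ⟨M, hM⟩ : ∃ M : ℕ, B ≤ M := exists_nat_ge _
  have hfin : (Set.univ.pi fun _ : Fin 4 => (Int.cast '' Set.Icc (-(M : ℤ)) M : Set ℝ)).Finite :=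
    Set.Finite.pi fun _ => (Set.finite_Icc _ _).image _
  refine hfin.subset ?_
  rintro c ⟨hc, hB⟩ i -
  obtain ⟨z, hz⟩ := hc.1 i
  refine ⟨z, ?_, hz.symm⟩
  have h3 := hc.2.2
  have hn := hc.2.1
  simp only [lor] at hn
  have hb : |c i| ≤ M := by
    refine (abs_le_of_sq_le_sq ?_ h3.le).trans (hB.trans hM)
    fin_cases i <;> simp <;>
      nlinarith [mul_self_nonneg (c 0), mul_self_nonneg (c 1), mul_self_nonneg (c 2)]
  rw [hz] at hb
  exact abs_le.1 (by exact_mod_cast hb)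

theorem isCusp_vertex : IsCusp ![1, 0, 0, 1] :=
  ⟨by simpa using isInt_vec 1 0 0 1, by norm_num [lor_vec], by simp⟩

/-- A cocompact closed set invariant under a group of integral isometries has a point of
maximal height over all cusps. -/
theorem exists_forall_neg_lor_le {Γ : Subgroup OPlus} (hΓ : Γ ≤ intGroup) {T : Set H3}
    (hT : IsClosed T) (hne : T.Nonempty) (hinv : ∀ g ∈ Γ, ∀ x ∈ T, g • x ∈ T) {B : ℝ}
    (hB : ∀ x ∈ T, ∃ g ∈ Γ, (g • x).1 3 ≤ B) :
    ∃ x ∈ T, ∃ c, IsCusp c ∧ ∀ y ∈ T, ∀ d, IsCusp d → -lor x.1 c ≤ -lor y.1 d := by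
  obtain ⟨x₀, hx₀, hx₀B⟩ : ∃ x ∈ T, x.1 3 ≤ B := by
    obtain ⟨x, hx⟩ := hne
    obtain ⟨g, hg, h⟩ := hB x hx
    exact ⟨_, hinv g hg x hx, h⟩
  set h₀ := -lor x₀.1 ![1, 0, 0, 1] with hh₀
  have hh₀0 : 0 < h₀ := by have := isCusp_vertex.lor_neg x₀; linarith
  have hbound : ∀ y : H3, y.1 3 ≤ B → ∀ d, IsCusp d → -lor y.1 d ≤ h₀ →
      d 3 ≤ 2 * B * h₀ := by
    intro y hy d hd hle
    have h1 := coord_le_of_causal hd.2.1.le hd.2.2 y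
    rw [lor_comm d] at h1
    have h2 := y.2.2
    have h3 := hd.lor_neg y
    exact h1.trans (mul_le_mul (by linarith) hle (by linarith) (by linarith))
  -- Only finitely many cusps can compete with `h₀` over the bounded part of `T`.
  have hK : IsCompact ((T ∩ {x : H3 | x.1 3 ≤ B}) ×ˢ {c | IsCusp c ∧ c 3 ≤ 2 * B * h₀}) :=
    ((isCompact_setOf_le B).inter_left hT).prod (finite_setOf_isCusp_le _).isCompact
  have hcont : Continuous fun q : H3 × (Fin 4 → ℝ) => -lor q.1.1 q.2 := by
    have h1 : Continuous fun q : H3 × (Fin 4 → ℝ) => q.1.1 := continuous_coe.comp continuous_fst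
    have h2 : ∀ i, Continuous fun q : H3 × (Fin 4 → ℝ) => q.1.1 i := fun i =>
      (continuous_apply i).comp h1
    have h3 : ∀ i, Continuous fun q : H3 × (Fin 4 → ℝ) => q.2 i := fun i =>
      (continuous_apply i).comp continuous_snd
    exact (((((h2 0).mul (h3 0)).add ((h2 1).mul (h3 1))).add ((h2 2).mul (h3 2))).sub
      ((h2 3).mul (h3 3))).neg
  obtain ⟨⟨x, c⟩, ⟨⟨hxT, hxB⟩, hc, hcB⟩, hmin⟩ := hK.exists_isMinOn
    ⟨(x₀, ![1, 0, 0, 1]), ⟨hx₀, hx₀B⟩, isCusp_vertex, hbound x₀ hx₀B _ isCusp_vertex le_rfl⟩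
    hcont.continuousOn
  rw [isMinOn_iff] at hmin
  refine ⟨x, hxT, c, hc, fun y hy d hd => ?_⟩
  obtain ⟨g, hg, hgB⟩ := hB y hy
  have hgd := hd.map (hΓ hg)
  -- Translating the point and the cusp together keeps their product.
  have e : -lor y.1 d = -lor (g • y).1 (act g d) := by rw [coe_smul, lor_act]
  rw [e]
  rcases le_total (-lor (g • y).1 (act g d)) h₀ with hle | hle
  · exact hmin (g • y, act g d) ⟨⟨hinv g hg y hy, hgB⟩, hgd, hbound _ hgB _ hgd hle⟩
  · exact (hmin (x₀, ![1, 0, 0, 1]) ⟨⟨hx₀, hx₀B⟩, isCusp_vertex,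
      hbound x₀ hx₀B _ isCusp_vertex le_rfl⟩).trans hle

/-- A closed embedded totally geodesic surface yields a normal vector that is extremal with
respect to the cusps. -/
theorem IsClosedEmbeddedTotallyGeodesicSurface.exists_normal {Γ : Subgroup OPlus}
    (hΓ : Γ ≤ intGroup) {S : Set (HQuot Γ)}
    (hS : IsClosedEmbeddedTotallyGeodesicSurface Γ S) :
    ∃ n c : Fin 4 → ℝ, lor n n = 1 ∧ (∀ g ∈ Γ, 1 ≤ |lor n (act g n)|) ∧ IsCusp c ∧
      lor n c ≠ 0 ∧ ∀ d, IsCusp d → |lor n c| ≤ |lor n d| := by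
  obtain ⟨hne, hcomp, hloc⟩ := hS
  have := t2Space_HQuot hΓ
  set T : Set H3 := {x | proj Γ x ∈ S} with hTdef
  have hT : IsClosed T := hcomp.isClosed.preimage (continuous_proj Γ)
  have hTne : T.Nonempty := by
    obtain ⟨s, hs⟩ := hne
    induction s using Quotient.inductionOn with
    | h x => exact ⟨x, hs⟩
  have hinv : ∀ g ∈ Γ, ∀ x ∈ T, g • x ∈ T := by
    intro g hg x hx
    have e : proj Γ (g • x) = proj Γ x := proj_eq_iff.2 ⟨g, hg, rfl⟩
    rw [hTdef, Set.mem_ofPred_eq, e]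
    exact hx
  have hplane : IsLocallyPlane T := by
    intro x hx
    obtain ⟨P, ⟨n, hn, rfl⟩, hxP, U, hU, hxU, hUS⟩ := hloc x hx
    have hs : 0 < √(lor n n) := Real.sqrt_pos.2 hn
    have hz : ∀ y : H3, lor y.1 ((√(lor n n))⁻¹ • n) = 0 ↔ lor y.1 n = 0 := fun y => by
      rw [lor_smul_right, mul_eq_zero, or_iff_right (inv_pos.2 hs).ne']
    refine ⟨(√(lor n n))⁻¹ • n, ?_, (hz x).2 hxP, U, hU, hxU, fun y hy => ?_⟩
    · rw [lor_smul_left, lor_smul_right, ← mul_assoc, ← mul_inv, Real.mul_self_sqrt hn.le,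
        inv_mul_cancel₀ hn.ne']
    · rw [hz]
      exact hUS y hy
  obtain ⟨B, hB⟩ := exists_coord_le_of_isCompact hcomp
  obtain ⟨x, hx, c, hc, hmin⟩ := exists_forall_neg_lor_le hΓ hT hTne hinv hB
  obtain ⟨n, hn, hxn⟩ := hplane.exists_planeNormal hT hx
  have hlow : ∀ d, IsCusp d → -lor x.1 c ≤ |lor n d| := by
    intro d hd
    by_contra! hlt
    obtain ⟨y, hy, hyd⟩ := exists_neg_lor_lt hn.1 hxn hd hlt
    exact absurd (hmin y (hn.2 y hy) d hd) (not_le.2 hyd)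
  have hxc := hc.lor_neg x
  -- With `hlow` this identifies the minimal value as `|lor n c|`: `x` is the point of its plane
  -- closest to the cusp.
  have hup : |lor n c| ≤ -lor x.1 c := by
    have h := neg_lor_self_le_sq (w := c - lor n c • n) x
    have e1 : lor (c - lor n c • n) (c - lor n c • n) = -lor n c ^ 2 := by
      rw [lor_sub_left, lor_sub_right, lor_sub_right, lor_smul_left, lor_smul_left,
        lor_smul_right, lor_smul_right, hn.1, hc.2.1, lor_comm c]
      ring
    rw [e1, lor_sub_right, lor_smul_right, hxn, mul_zero, sub_zero, neg_neg] at h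
    refine abs_le_of_sq_le_sq (by rwa [neg_sq]) (by linarith)
  refine ⟨n, c, hn.1, fun g hg => hplane.one_le_abs_lor hn ⟨by rw [lor_act, hn.1], ?_⟩, hc, ?_,
    fun d hd => hup.trans (hlow d hd)⟩
  · intro y hy
    have h1 := hn.2 (g⁻¹ • y) (by
      rw [coe_smul, lor_act_left, inv_inv]; exact hy)
    simpa using hinv g hg _ h1
  · intro h0
    have := hlow c hc
    rw [h0, abs_zero] at this
    linarith

theorem IsClosedEmbeddedTotallyGeodesicSurface.exists_admissible {k : Fin 3 → Fin 8}
    {Γ : Subgroup OPlus} (hk : pairingGroupPlus k ≤ Γ) (hΓ : Γ ≤ intGroup) {S : Set (HQuot Γ)}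
    (hS : IsClosedEmbeddedTotallyGeodesicSurface Γ S) :
    ∃ N c : Fin 4 → ℝ, Admissible k N ∧ IsCusp c ∧ lor N c = -1 := by
  obtain ⟨n, c, hn, hemb, hc, h0, hmin⟩ := hS.exists_normal hΓ
  set r := -(lor n c)⁻¹ with hr
  have hr0 : r ≠ 0 := neg_ne_zero.2 (inv_ne_zero h0)
  refine ⟨r • n, c, ⟨?_, fun g hg => ?_, fun d hd => ?_⟩, hc, ?_⟩
  · rw [lor_smul_left, lor_smul_right, hn, mul_one]
    exact mul_self_pos.2 hr0
  · rw [act_smul, lor_smul_left, lor_smul_right, lor_smul_left, lor_smul_right, hn, mul_one,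
      ← mul_assoc, abs_mul, abs_mul_self]
    exact le_mul_of_one_le_right (mul_self_nonneg r) (hemb g (hk hg))
  · rw [lor_smul_left, abs_mul, hr, abs_neg, abs_inv, inv_mul_eq_div,
      one_le_div (abs_pos.2 h0)]
    exact hmin d hd
  · rw [lor_smul_left, hr, neg_mul, inv_mul_cancel₀ h0]

end CensusHyp

end

/-- For each of the codes `537`, `152`, `173`, `136`, `156`, the orientable double cover of the
census manifold with that code contains no closed embedded totally geodesic surface, and neither
does the census manifold itself. -/
theorem lemma2p4 (k : Fin 3 → Fin 8)
    (hk : k = ![5, 3, 7] ∨ k = ![1, 5, 2] ∨ k = ![1, 7, 3] ∨ k = ![1, 3, 6] ∨ k = ![1, 5, 6]) :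
    (¬ ∃ S : Set (CensusHyp.CensusDoubleCover k),
      CensusHyp.IsClosedEmbeddedTotallyGeodesicSurface (CensusHyp.pairingGroupPlus k) S) ∧
    (¬ ∃ S : Set (CensusHyp.CensusManifold k),
      CensusHyp.IsClosedEmbeddedTotallyGeodesicSurface (CensusHyp.pairingGroup k) S) := by
  have hle : CensusHyp.pairingGroupPlus k ≤ CensusHyp.pairingGroup k := inf_le_left
  have hint := CensusHyp.pairingGroup_le_intGroup k
  constructor
  · rintro ⟨S, hS⟩
    obtain ⟨N, c, hN, hc, h⟩ := hS.exists_admissible (k := k) le_rfl (hle.trans hint)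
    exact hN.not_lor_cusp_eq hk hc h
  · rintro ⟨S, hS⟩
    obtain ⟨N, c, hN, hc, h⟩ := hS.exists_admissible hle hint
    exact hN.not_lor_cusp_eq hk hc h
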